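/- Let $A$ be a real symmetric $n\times n$ matrix of rank $r$, with spectral decomposition $A=\sum_{i=1}^n\lambda_i u_iu_i^\top$, where $\lambda_1\ge\dots\ge\lambda_n$ and $u_1,\dots,u_n$ is an orthonormal basis of eigenvectors, and with singular values $\sigma_1\ge\sigma_2\ge\cdots$ (with $\sigma_i=0$ for $i>r$). Let $E$ be a real symmetric $n\times n$ matrix and $\tilde A=A+E$. Let $1\le p\le r$ and let $A_p$, $\tilde A_p$ be best rank-$p$ approximations of $A$, $\tilde A$, that is, the sums of the first $p$ terms of a singular value decomposition (with singular values in decreasing order). $\|\cdot\|$ is the spectral norm. Let $0\le k\le p$ be an integer such that $\lambda_1\ge\dots\ge\lambda_k>0\ge\lambda_{n-(p-k)+1}\ge\dots\ge\lambda_n$ and, for $S=\{1,\dots,k,\,n-(p-k)+1,\dots,n\}$, $\{\sigma_1,\dots,\sigma_p\}=\{|\lambda_i|: i\in S\}$ with multiplicity. Put $\delta_p=\sigma_p-\sigma_{p+1}$, assume $\delta_p>0$, and put $$\delta_S=\min\{\lambda_k-\lambda_{k+1},\ \lambda_{n-(p-k)}-\lambda_{n-(p-k)+1}\},$$ with the conventions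 $\lambda_0=+\infty$, $\lambda_{n+1}=-\infty$ (so that the first difference is $+\infty$ when $k=0$ and the second when $k=p$; a term divided by $\delta_S=+\infty$ is $0$). Let $$x=\max_{i,j:\ \lambda_i,\lambda_j\neq0}|u_i^\top E u_j|,\qquad y=\max_{i<j:\ \lambda_i,\lambda_j\ne0}|Eu_i\cdot Eu_j|$$ (with $y=0$ if $r=1$). If $$\max\left\{\frac{p\|E\|}{\sigma_p},\ \frac{r^2x}{\delta_p},\ \frac{\sqrt r\,\|E\|}{\sqrt{\sigma_p\delta_p}}\right\}\le\frac1{24},$$ then $$\|\tilde A_p-A_p\|\le 8\sigma_p\left(\frac{\|E\|}{\sigma_p}+\frac{rx}{\delta_S}+\frac{r^2y}{\sigma_p\delta_S}\right).$$ -/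

import Mathlib

open scoped Matrix Matrix.Norms.L2Operator

/-- The `i`-th largest singular value `σ_i` of a real `m × n` matrix, for `i ≥ 1`, counted with
multiplicity (so `σ_i = 0` when `i` exceeds the rank). Mathlib's sequence starts at index `0`. -/
noncomputable def sval {m n : ℕ} (M : Matrix (Fin m) (Fin n) ℝ) (i : ℕ) : ℝ :=
  (Matrix.toEuclideanLin M).singularValues (i - 1)

/-- The singular value gap `δ_i = σ_i - σ_{i+1}`, for `i ≥ 1`. -/
noncomputable def svalGap {m n : ℕ} (M : Matrix (Fin m) (Fin n) ℝ) (i : ℕ) : ℝ :=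
  sval M i - sval M (i + 1)

/-- The rank one matrix `u vᵀ`. -/
def outer {m n : ℕ} (u : EuclideanSpace ℝ (Fin m)) (v : EuclideanSpace ℝ (Fin n)) :
    Matrix (Fin m) (Fin n) ℝ :=
  Matrix.of fun a b => u a * v b

/-- `M = ∑ i, s i • u i (v i)ᵀ` is a singular value decomposition: `s` is nonnegative and
decreasing, and the left and the right singular vectors are orthonormal. -/
structure IsSVD {m n ρ : ℕ} (M : Matrix (Fin m) (Fin n) ℝ) (s : Fin ρ → ℝ)
    (u : Fin ρ → EuclideanSpace ℝ (Fin m)) (v : Fin ρ → EuclideanSpace ℝ (Fin n)) : Prop where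
  nonneg : ∀ i, 0 ≤ s i
  antitone : Antitone s
  left_orthonormal : Orthonormal ℝ u
  right_orthonormal : Orthonormal ℝ v
  eq_sum : M = ∑ i, s i • outer (u i) (v i)

/-- `B = ∑_{i ≤ p} σ_i u_i v_iᵀ` for some singular value decomposition `M = ∑_i σ_i u_i v_iᵀ`,
that is, `B` is a best rank `p` approximation `M_p` of `M`. It is unique when `σ_p > σ_{p+1}`. -/
def IsRankApprox {m n : ℕ} (p : ℕ) (M B : Matrix (Fin m) (Fin n) ℝ) : Prop :=
  ∃ (ρ : ℕ) (s : Fin ρ → ℝ) (u : Fin ρ → EuclideanSpace ℝ (Fin m))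
    (v : Fin ρ → EuclideanSpace ℝ (Fin n)),
    IsSVD M s u v ∧ B = ∑ i with i.val < p, s i • outer (u i) (v i)

/-- `A = ∑ i, lam i • u i (u i)ᵀ` is a spectral decomposition with eigenvalues
`λ_1 ≥ ⋯ ≥ λ_n`, where `λ_i` is `lam` at the index of value `i - 1`. -/
structure IsSpectralDecomp {n : ℕ} (A : Matrix (Fin n) (Fin n) ℝ) (lam : Fin n → ℝ)
    (u : OrthonormalBasis (Fin n) ℝ (EuclideanSpace ℝ (Fin n))) : Prop where
  antitone : Antitone lam
  eq_sum : A = ∑ i, lam i • outer (u i) (u i)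

/-- The skewness parameter `x = max |u_iᵀ E u_j|`, over the eigenvectors `u_i`, `u_j` of the
nonzero eigenvalues. -/
noncomputable def skewX {n : ℕ} (E : Matrix (Fin n) (Fin n) ℝ) (lam : Fin n → ℝ)
    (u : OrthonormalBasis (Fin n) ℝ (EuclideanSpace ℝ (Fin n))) : ℝ :=
  ⨆ ij : {ij : Fin n × Fin n // lam ij.1 ≠ 0 ∧ lam ij.2 ≠ 0},
    |inner ℝ (u ij.1.1) (Matrix.toEuclideanLin E (u ij.1.2))|

/-- The skewness parameter `y = max |E u_i ⬝ E u_j|`, over the pairs of distinct eigenvectors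
`u_i`, `u_j` of the nonzero eigenvalues (`0` if there is no such pair). -/
noncomputable def skewY {n : ℕ} (E : Matrix (Fin n) (Fin n) ℝ) (lam : Fin n → ℝ)
    (u : OrthonormalBasis (Fin n) ℝ (EuclideanSpace ℝ (Fin n))) : ℝ :=
  ⨆ ij : {ij : Fin n × Fin n // ij.1 < ij.2 ∧ lam ij.1 ≠ 0 ∧ lam ij.2 ≠ 0},
    |inner ℝ (Matrix.toEuclideanLin E (u ij.1.1)) (Matrix.toEuclideanLin E (u ij.1.2))|

/-- The index set `S = {1, …, k, n-(p-k)+1, …, n}`, shifted to start at `0`. -/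
def leadingSet (n p k : ℕ) : Finset (Fin n) :=
  {i | i.val < k ∨ n - (p - k) ≤ i.val}

/-- The `k` largest eigenvalues, which are positive, and the `p - k` smallest ones, which are not,
have as absolute values the `p` leading singular values of `A` (with multiplicity). -/
structure IsLeadingSplit {n : ℕ} (A : Matrix (Fin n) (Fin n) ℝ) (lam : Fin n → ℝ)
    (p k : ℕ) : Prop where
  le : k ≤ p
  pos : ∀ i : Fin n, i.val < k → 0 < lam i
  nonpos : ∀ i : Fin n, n - (p - k) ≤ i.val → lam i ≤ 0
  abs_eq : (leadingSet n p k).val.map (fun i => |lam i|) =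
    (Multiset.range p).map (fun i => sval A (i + 1))

/-- The eigenvalue `λ_i`, `1 ≤ i ≤ n`, with the conventions `λ_0 = +∞` and `λ_{n+1} = -∞`. -/
noncomputable def eigExt {n : ℕ} (lam : Fin n → ℝ) (i : ℕ) : EReal :=
  if i = 0 then ⊤ else if h : i - 1 < n then (lam ⟨i - 1, h⟩ : EReal) else ⊥

/-- The eigenvalue gap
`δ_S = min {λ_k - λ_{k+1}, λ_{n-(p-k)} - λ_{n-(p-k)+1}}`. The conventions of `eigExt` make
the first difference `+∞` if `k = 0` and the second one `+∞` if `k = p`. -/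
noncomputable def eigGap {n : ℕ} (lam : Fin n → ℝ) (p k : ℕ) : EReal :=
  min (eigExt lam k - eigExt lam (k + 1))
    (eigExt lam (n - (p - k)) - eigExt lam (n - (p - k) + 1))

/-! ### Diagonal operators, spectral projections, subspace gaps and the Sylvester bound. -/

section DiagOp

open InnerProductSpace

variable {ι H : Type*} [Fintype ι] [NormedAddCommGroup H] [InnerProductSpace ℝ H]

/-! Let P, Q, N be the spectral projections of A onto the eigenvectors indexed by S, the other
eigenvectors of nonzero eigenvalues, and the kernel; let M = A + E. A min-max count
(`eigenvalue_location`) shows, for p < n, that exactly p eigenvalues of M exceed (σ_p + σ_{p+1})/2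
in absolute value, k of them positive. Between nonzero eigenvectors of A only a compression of E
acts, of norm at most rx, and the coupling with the kernel is absorbed by ‖E‖² ≤ σ_p δ_p / 576. If R
projects onto the eigenvectors of these p eigenvalues, the two approximations are MR and AP
(`IsRankApprox.toEuclideanCLM_eq`).

Cutting MR - AP along P gives four blocks, each bounded by multiples of ‖E‖ and σ_p‖RQ‖
(`SplitSpectrum.norm_sub_le`), so everything rests on ‖RQ‖. For the positive and the negative part
of R separately, the Sylvester bound `gap_mul_norm_le` controls ‖RQ‖ by ‖REQ‖ divided by essentially
δ_S. Estimating ‖REQ‖ by ‖E‖ would lose the skewness. Instead 1 = P + Q + N is inserted after R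
(`norm_mul_mul_le_of_resolution`). The P and Q terms involve only the entries u_iᵀEu_j, whence x.
Since AN = 0, RN = (M⁻¹R)EN with M inverted on the range of R, so the N term becomes second order:
it produces E², whose entries between P and Q are Eu_i·Eu_j, whence y. Terms that contain ‖RQ‖ again
are absorbed on the left, and the remaining ‖E‖³ is worth a small multiple of ‖E‖.

If p = n, both approximations are exact and their difference is E. -/

/-- The operator `∑ i, f i • b i (b i)ᵀ`, diagonal in the orthonormal basis `b`. -/
noncomputable def diagOp (b : OrthonormalBasis ι ℝ H) (f : ι → ℝ) : H →L[ℝ] H :=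
  ∑ i, f i • rankOne ℝ (b i) (b i)

/-- The orthogonal projection onto the span of the `b i` with `i ∈ s`. -/
noncomputable def spanProj [DecidableEq ι] (b : OrthonormalBasis ι ℝ H) (s : Finset ι) :
    H →L[ℝ] H :=
  diagOp b fun i => if i ∈ s then 1 else 0

theorem inner_diagOp (b : OrthonormalBasis ι ℝ H) (f : ι → ℝ) (i : ι) (v : H) :
    inner ℝ (b i) (diagOp b f v) = f i * inner ℝ (b i) v := by
  classical
  simp [diagOp, inner_sum, inner_smul_right, b.inner_eq_ite]

theorem OrthonormalBasis.ext_inner (b : OrthonormalBasis ι ℝ H) {v w : H}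
    (h : ∀ i, inner ℝ (b i) v = inner ℝ (b i) w) : v = w := by
  rw [← b.sum_repr' v, ← b.sum_repr' w]
  simp [h]

theorem OrthonormalBasis.norm_sq_eq_sum (b : OrthonormalBasis ι ℝ H) (v : H) :
    ‖v‖ ^ 2 = ∑ i, inner ℝ (b i) v ^ 2 := by
  rw [← b.sum_sq_norm_inner_right v]
  simp

theorem OrthonormalBasis.inner_eq_sum (b : OrthonormalBasis ι ℝ H) (v w : H) :
    inner ℝ v w = ∑ i, inner ℝ (b i) v * inner ℝ (b i) w := by
  rw [← b.sum_inner_mul_inner v w]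
  simp [real_inner_comm]

theorem eq_diagOp_of_apply (b : OrthonormalBasis ι ℝ H) (f : ι → ℝ) (T : H →L[ℝ] H)
    (h : ∀ i, T (b i) = f i • b i) : T = diagOp b f := by
  classical
  have : (T : H →ₗ[ℝ] H) = diagOp b f := by
    refine b.toBasis.ext fun i => b.ext_inner fun j => ?_
    simp only [OrthonormalBasis.coe_toBasis, ContinuousLinearMap.coe_coe, h, inner_diagOp,
      inner_smul_right, b.inner_eq_ite]
    split_ifs with hij
    · rw [hij]
    · simp
  exact ContinuousLinearMap.coe_injective this

theorem diagOp_basis (b : OrthonormalBasis ι ℝ H) (f : ι → ℝ) (i : ι) :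
    diagOp b f (b i) = f i • b i := by
  classical
  refine b.ext_inner fun j => ?_
  simp only [inner_diagOp, inner_smul_right, b.inner_eq_ite]
  split_ifs with hij
  · rw [hij]
  · simp

theorem diagOp_mul (b : OrthonormalBasis ι ℝ H) (f g : ι → ℝ) :
    diagOp b f * diagOp b g = diagOp b (f * g) := by
  refine eq_diagOp_of_apply b _ _ fun i => ?_
  simp [diagOp_basis, smul_smul, mul_comm]

theorem diagOp_add (b : OrthonormalBasis ι ℝ H) (f g : ι → ℝ) :
    diagOp b f + diagOp b g = diagOp b (f + g) := by
  refine eq_diagOp_of_apply b _ _ fun i => ?_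
  simp [diagOp_basis, add_smul]

theorem diagOp_sub (b : OrthonormalBasis ι ℝ H) (f g : ι → ℝ) :
    diagOp b f - diagOp b g = diagOp b (f - g) := by
  refine eq_diagOp_of_apply b _ _ fun i => ?_
  simp [diagOp_basis, sub_smul]

theorem diagOp_neg (b : OrthonormalBasis ι ℝ H) (f : ι → ℝ) :
    -diagOp b f = diagOp b (-f) := by
  refine eq_diagOp_of_apply b _ _ fun i => ?_
  simp [diagOp_basis]

theorem diagOp_one (b : OrthonormalBasis ι ℝ H) : diagOp b 1 = 1 := by
  refine (eq_diagOp_of_apply b _ _ fun i => ?_).symm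
  simp

theorem inner_diagOp_comm (b : OrthonormalBasis ι ℝ H) (f : ι → ℝ) (v w : H) :
    inner ℝ (diagOp b f v) w = inner ℝ v (diagOp b f w) := by
  rw [b.inner_eq_sum, b.inner_eq_sum]
  simp only [inner_diagOp]
  exact Finset.sum_congr rfl fun i _ => by ring

theorem star_diagOp [CompleteSpace H] (b : OrthonormalBasis ι ℝ H) (f : ι → ℝ) :
    star (diagOp b f) = diagOp b f := by
  rw [ContinuousLinearMap.star_eq_adjoint, eq_comm, ContinuousLinearMap.eq_adjoint_iff]
  exact inner_diagOp_comm b f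

theorem inner_diagOp_self (b : OrthonormalBasis ι ℝ H) (f : ι → ℝ) (v : H) :
    inner ℝ v (diagOp b f v) = ∑ i, f i * inner ℝ (b i) v ^ 2 := by
  rw [b.inner_eq_sum]
  simp only [inner_diagOp]
  exact Finset.sum_congr rfl fun i _ => by ring

theorem norm_diagOp_le (b : OrthonormalBasis ι ℝ H) {f : ι → ℝ} {c : ℝ} (hc : 0 ≤ c)
    (h : ∀ i, |f i| ≤ c) : ‖diagOp b f‖ ≤ c := by
  refine ContinuousLinearMap.opNorm_le_bound _ hc fun v => ?_
  refine le_of_sq_le_sq ?_ (by positivity)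
  rw [mul_pow, b.norm_sq_eq_sum, b.norm_sq_eq_sum, Finset.mul_sum]
  refine Finset.sum_le_sum fun i _ => ?_
  rw [inner_diagOp, mul_pow]
  exact mul_le_mul_of_nonneg_right (sq_le_sq' (abs_le.1 (h i)).1 (abs_le.1 (h i)).2) (sq_nonneg _)

variable [DecidableEq ι]

theorem inner_spanProj (b : OrthonormalBasis ι ℝ H) (s : Finset ι) (i : ι) (v : H) :
    inner ℝ (b i) (spanProj b s v) = if i ∈ s then inner ℝ (b i) v else 0 := by
  simp [spanProj, inner_diagOp]

theorem norm_spanProj_le (b : OrthonormalBasis ι ℝ H) (s : Finset ι) : ‖spanProj b s‖ ≤ 1 :=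
  norm_diagOp_le b zero_le_one fun i => by split_ifs <;> simp

theorem spanProj_mul_self (b : OrthonormalBasis ι ℝ H) (s : Finset ι) :
    spanProj b s * spanProj b s = spanProj b s := by
  rw [spanProj, diagOp_mul]
  congr 1
  ext i
  simp

theorem spanProj_compl (b : OrthonormalBasis ι ℝ H) (s : Finset ι) :
    spanProj b sᶜ = 1 - spanProj b s := by
  rw [spanProj, spanProj, ← diagOp_one b, diagOp_sub]
  congr 1
  ext i
  by_cases hs : i ∈ s <;> simp [hs]

theorem spanProj_union (b : OrthonormalBasis ι ℝ H) {s t : Finset ι} (h : Disjoint s t) :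
    spanProj b (s ∪ t) = spanProj b s + spanProj b t := by
  rw [spanProj, spanProj, spanProj, diagOp_add]
  congr 1
  ext i
  by_cases hs : i ∈ s
  · simp [hs, Finset.disjoint_left.1 h hs]
  · simp [hs]

/-- If the entries of `T` in the orthonormal basis `b` are at most `x` on a block with at most
`r` rows and columns, the norm of the block is at most `r * x`. -/
theorem norm_spanProj_mul_mul_le (b : OrthonormalBasis ι ℝ H) (T : H →L[ℝ] H)
    (s t : Finset ι) {r : ℕ} (hs : s.card ≤ r) (ht : t.card ≤ r) {x : ℝ} (hx : 0 ≤ x)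
    (h : ∀ i ∈ s, ∀ j ∈ t, |inner ℝ (b i) (T (b j))| ≤ x) :
    ‖spanProj b s * T * spanProj b t‖ ≤ r * x := by
  refine ContinuousLinearMap.opNorm_le_bound _ (by positivity) fun v => ?_
  refine le_of_sq_le_sq ?_ (by positivity)
  -- Cauchy-Schwarz in each row; summing over at most `r` rows gives the Hilbert-Schmidt type bound.
  have key : ∀ i ∈ s, inner ℝ (b i) (T (spanProj b t v)) ^ 2 ≤ r * x ^ 2 * ‖v‖ ^ 2 := by
    intro i hi
    have hv : spanProj b t v = ∑ j ∈ t, inner ℝ (b j) v • b j := by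
      rw [← b.sum_repr' (spanProj b t v)]
      simp [inner_spanProj, ite_smul]
    rw [hv, map_sum, inner_sum]
    simp only [map_smul, inner_smul_right]
    calc (∑ j ∈ t, inner ℝ (b j) v * inner ℝ (b i) (T (b j))) ^ 2
        ≤ (∑ j ∈ t, inner ℝ (b j) v ^ 2) * ∑ j ∈ t, inner ℝ (b i) (T (b j)) ^ 2 :=
          Finset.sum_mul_sq_le_sq_mul_sq _ _ _
      _ ≤ ‖v‖ ^ 2 * (r * x ^ 2) := by
          refine mul_le_mul ?_ ?_ (Finset.sum_nonneg fun _ _ => sq_nonneg _) (sq_nonneg _)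
          · rw [b.norm_sq_eq_sum]
            exact Finset.sum_le_sum_of_subset_of_nonneg (Finset.subset_univ _)
              fun _ _ _ => sq_nonneg _
          · calc ∑ j ∈ t, inner ℝ (b i) (T (b j)) ^ 2 ≤ ∑ _j ∈ t, x ^ 2 :=
                  Finset.sum_le_sum fun j hj =>
                    sq_le_sq' (abs_le.1 (h i hi j hj)).1 (abs_le.1 (h i hi j hj)).2
              _ ≤ r * x ^ 2 := by
                  rw [Finset.sum_const, nsmul_eq_mul]
                  gcongr
      _ = r * x ^ 2 * ‖v‖ ^ 2 := by ring
  calc ‖(spanProj b s * T * spanProj b t) v‖ ^ 2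
      = ∑ i ∈ s, inner ℝ (b i) (T (spanProj b t v)) ^ 2 := by
        rw [b.norm_sq_eq_sum]
        simp [inner_spanProj, ite_pow]
    _ ≤ ∑ _i ∈ s, r * x ^ 2 * ‖v‖ ^ 2 := Finset.sum_le_sum key
    _ ≤ r * (r * x ^ 2 * ‖v‖ ^ 2) := by
        rw [Finset.sum_const, nsmul_eq_mul]
        gcongr
    _ = (r * x * ‖v‖) ^ 2 := by ring

/-- If two spans of equal dimension are given by orthonormal bases, the gap between them is
bounded by that in the other direction. -/
theorem norm_spanProj_compl_mul_le [CompleteSpace H] (u w : OrthonormalBasis ι ℝ H)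
    {s t : Finset ι} (hst : t.card = s.card) :
    ‖(1 - spanProj w t) * spanProj u s‖ ≤ ‖spanProj w t * (1 - spanProj u s)‖ := by
  set P := spanProj u s with hP
  set R := spanProj w t with hR
  set c := ‖R * (1 - P)‖ with hc
  have hc0 : 0 ≤ c := norm_nonneg _
  have hcP : ∀ v, ‖(1 - P) (R v)‖ ≤ c * ‖v‖ := by
    have : c = ‖(1 - P) * R‖ := by
      rw [hc, ← norm_star (R * (1 - P)), star_mul, star_sub, star_one, hP, hR, spanProj, spanProj,
        star_diagOp, star_diagOp]
    intro v
    rw [this]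
    exact ContinuousLinearMap.le_opNorm ((1 - P) * R) v
  have pyth : ∀ (b : OrthonormalBasis ι ℝ H) (a : Finset ι) (v : H),
      ‖spanProj b a v‖ ^ 2 + ‖(1 - spanProj b a) v‖ ^ 2 = ‖v‖ ^ 2 := by
    intro b a v
    rw [← spanProj_compl, b.norm_sq_eq_sum, b.norm_sq_eq_sum, b.norm_sq_eq_sum v,
      ← Finset.sum_add_distrib]
    refine Finset.sum_congr rfl fun i _ => ?_
    by_cases hi : i ∈ a <;> simp [inner_spanProj, hi]
  rcases le_or_gt 1 c with h1 | h1
  · refine le_trans ?_ h1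
    rw [hR, ← spanProj_compl]
    exact (norm_mul_le _ _).trans
      (mul_le_one₀ (norm_spanProj_le _ _) (norm_nonneg _) (norm_spanProj_le _ _))
  -- the compression of `P` to the range of `R` is onto the range of `P`
  have surj : ∀ z, ∃ v, R v = v ∧ P v = P z := by
    let φ : (t → ℝ) →ₗ[ℝ] H := Fintype.linearCombination ℝ fun j : t => w j
    let ψ : H →ₗ[ℝ] (s → ℝ) := LinearMap.pi fun i : s => (innerₛₗ ℝ (u i) : H →ₗ[ℝ] ℝ)
    have hφ : ∀ f, R (φ f) = φ f := by
      intro f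
      simp only [φ, Fintype.linearCombination_apply, map_sum, map_smul]
      refine Finset.sum_congr rfl fun j _ => ?_
      rw [hR, spanProj, diagOp_basis]
      simp
    have hψ : ∀ v v', ψ v = ψ v' → P v = P v' := by
      intro v v' h
      refine u.ext_inner fun i => ?_
      rw [hP, inner_spanProj, inner_spanProj]
      split_ifs with hi
      · exact congrFun h ⟨i, hi⟩
      · rfl
    -- If `P v = 0` with `v` in the range of `R`, then `v = (1 - P) (R v)`, so `‖v‖ ≤ c * ‖v‖` with
    -- `c < 1`. Equality of dimensions then turns injectivity into surjectivity.
    have hinj : Function.Injective (ψ ∘ₗ φ) := by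
      rw [← LinearMap.ker_eq_bot, LinearMap.ker_eq_bot']
      intro f hf
      have h0 : P (φ f) = 0 := by
        rw [hψ (φ f) 0 (by simpa using hf), map_zero]
      have h2 := hcP (φ f)
      rw [hφ, sub_apply, h0, sub_zero, one_apply_eq_self] at h2
      have h3 : φ f = 0 := by
        rw [← norm_eq_zero]
        nlinarith [norm_nonneg (φ f)]
      ext j
      have h4 : inner ℝ (w j) (φ f) = f j := by
        simp [φ, Fintype.linearCombination_apply, inner_sum, inner_smul_right, w.inner_eq_ite]
      rw [← h4, h3, inner_zero_right, Pi.zero_apply]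
    have hsurj := (LinearMap.injective_iff_surjective_of_finrank_eq_finrank
      (f := ψ ∘ₗ φ) (by simp [hst])).1 hinj
    intro z
    obtain ⟨f, hf⟩ := hsurj (ψ z)
    exact ⟨φ f, hφ f, hψ _ _ hf⟩
  refine ContinuousLinearMap.opNorm_le_bound _ hc0 fun z => ?_
  obtain ⟨v, hRv, hPv⟩ := surj z
  have e1 : ‖P v‖ ^ 2 ≤ ‖R (P v)‖ * ‖v‖ := by
    have hPP : P (P v) = P v := by
      rw [← mul_apply_eq_comp, hP, spanProj_mul_self]
    have : inner ℝ (R (P v)) v = ‖P v‖ ^ 2 := by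
      calc inner ℝ (R (P v)) v = inner ℝ (P v) (R v) := inner_diagOp_comm _ _ _ _
        _ = inner ℝ (P (P v)) v := by rw [hRv, hPP]
        _ = inner ℝ (P v) (P v) := inner_diagOp_comm _ _ _ _
        _ = ‖P v‖ ^ 2 := real_inner_self_eq_norm_sq _
    rw [← this]
    exact real_inner_le_norm _ _
  have e2 : (1 - c ^ 2) * ‖v‖ ^ 2 ≤ ‖P v‖ ^ 2 := by
    have h5 := hcP v
    rw [hRv] at h5
    have h6 := pyth u s v
    have h7 : ‖(1 - P) v‖ ^ 2 ≤ (c * ‖v‖) ^ 2 := by gcongr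
    rw [← hP] at h6
    nlinarith
  have e3 := pyth w t (P v)
  rw [← hR] at e3
  have e4 : ‖P v‖ ≤ ‖z‖ := by
    rw [hPv]
    have := ContinuousLinearMap.le_of_opNorm_le _ (norm_spanProj_le u s) z
    simpa using this
  -- Multiplying the square of `e1` by `1 - c ^ 2` and inserting `e2` leaves a common factor `‖P v‖
  -- ^ 2`, which cancels.
  have e5 : (1 - c ^ 2) * ‖P v‖ ^ 2 ≤ ‖R (P v)‖ ^ 2 := by
    rcases (norm_nonneg (P v)).eq_or_lt with h0 | h0
    · rw [← h0]; simp only [ne_eq, OfNat.ofNat_ne_zero, not_false_eq_true, zero_pow, mul_zero]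
      positivity
    · have h8 : (‖P v‖ ^ 2) ^ 2 ≤ (‖R (P v)‖ * ‖v‖) ^ 2 := by gcongr
      have h9 : 0 ≤ 1 - c ^ 2 := by nlinarith
      have h10 := mul_le_mul_of_nonneg_left h8 h9
      have h11 := mul_le_mul_of_nonneg_left e2 (sq_nonneg ‖R (P v)‖)
      have h12 : 0 < ‖P v‖ ^ 2 := by positivity
      refine le_of_mul_le_mul_right ?_ h12
      nlinarith
  rw [mul_apply_eq_comp, ← hPv]
  calc ‖(1 - R) (P v)‖ ≤ c * ‖P v‖ := by
        refine le_of_sq_le_sq ?_ (by positivity)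
        rw [mul_pow]
        linarith
    _ ≤ c * ‖z‖ := by gcongr

/-- If the quadratic form of a diagonal operator is at least `a` on a `k`-dimensional span, then
at least `k` of its diagonal entries are at least `a`. -/
theorem card_le_card_filter_le (u w : OrthonormalBasis ι ℝ H) (μ : ι → ℝ) (s : Finset ι) (a : ℝ)
    (h : ∀ v, spanProj u s v = v → a * ‖v‖ ^ 2 ≤ inner ℝ v (diagOp w μ v)) :
    s.card ≤ (Finset.univ.filter fun i => a ≤ μ i).card := by
  by_contra! hlt
  set t := Finset.univ.filter fun i => a ≤ μ i with ht
  let φ : (s → ℝ) →ₗ[ℝ] H := Fintype.linearCombination ℝ fun j : s => u j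
  let ψ : H →ₗ[ℝ] (t → ℝ) := LinearMap.pi fun i : t => (innerₛₗ ℝ (w i) : H →ₗ[ℝ] ℝ)
  have hφ : ∀ f, spanProj u s (φ f) = φ f := by
    intro f
    simp only [φ, Fintype.linearCombination_apply, map_sum, map_smul]
    refine Finset.sum_congr rfl fun j _ => ?_
    rw [spanProj, diagOp_basis]
    simp
  -- Dimension count: some nonzero vector of the span of the `u j` is orthogonal to every `w i` with
  -- `a ≤ μ i`, and there the form is strictly below `a * ‖v‖ ^ 2`.
  obtain ⟨f, hf, hf0⟩ := (Submodule.ne_bot_iff _).1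
    (LinearMap.ker_ne_bot_of_finrank_lt (f := ψ ∘ₗ φ) (by simpa using hlt))
  set v := φ f with hv
  have hv0 : v ≠ 0 := by
    intro h0
    refine hf0 (funext fun j => ?_)
    have h4 : inner ℝ (u j) (φ f) = f j := by
      simp [φ, Fintype.linearCombination_apply, inner_sum, inner_smul_right, u.inner_eq_ite]
    rw [← h4, ← hv, h0, inner_zero_right, Pi.zero_apply]
  have hz : ∀ i, a ≤ μ i → inner ℝ (w i) v = 0 := fun i hi =>
    congrFun (LinearMap.mem_ker.1 hf) ⟨i, by simp [ht, hi]⟩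
  have h1 := h v (hφ f)
  rw [inner_diagOp_self, w.norm_sq_eq_sum, Finset.mul_sum] at h1
  obtain ⟨i, hi⟩ : ∃ i, inner ℝ (w i) v ≠ 0 := by
    by_contra! h0
    exact hv0 (w.ext_inner fun i => by rw [h0, inner_zero_right])
  refine absurd h1 (not_le.2 (Finset.sum_lt_sum (fun j _ => ?_) ⟨i, Finset.mem_univ _, ?_⟩))
  · by_cases hj : a ≤ μ j
    · simp [hz j hj]
    · exact mul_le_mul_of_nonneg_right (not_le.1 hj).le (sq_nonneg _)
  · have : ¬ a ≤ μ i := fun h' => hi (hz i h')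
    exact mul_lt_mul_of_pos_right (not_le.1 this) (by positivity)

/-- A Sylvester equation bound for spectra separated by a line. -/
theorem gap_mul_norm_le (u w : OrthonormalBasis ι ℝ H) (lam μ : ι → ℝ) (s t : Finset ι) {a b : ℝ}
    (ha : ∀ i ∈ s, a ≤ μ i) (hb : ∀ j ∈ t, lam j ≤ b) :
    (a - b) * ‖spanProj w s * spanProj u t‖ ≤
      ‖spanProj w s * (diagOp w μ - diagOp u lam) * spanProj u t‖ := by
  -- Shifting both operators by the same `c` leaves their difference unchanged and makes the
  -- relevant spectra nonnegative, so the one-sided bounds `a` and `b` become bounds on the norms of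
  -- `L` and `G`.
  obtain ⟨c, hc⟩ : ∃ c : ℝ, 0 < c + a ∧ 0 ≤ c + b ∧ ∀ j, 0 ≤ c + lam j := by
    refine ⟨|a| + |b| + 1 + ∑ j, |lam j|, ?_, ?_, fun j => ?_⟩
    · linarith [neg_abs_le a, abs_nonneg b, Finset.sum_nonneg (s := Finset.univ)
        fun (j : ι) _ => abs_nonneg (lam j)]
    · linarith [neg_abs_le b, abs_nonneg a, Finset.sum_nonneg (s := Finset.univ)
        fun (j : ι) _ => abs_nonneg (lam j)]
    · linarith [neg_abs_le (lam j), abs_nonneg a, abs_nonneg b,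
        Finset.single_le_sum (s := Finset.univ) (f := fun j : ι => |lam j|)
          (fun j _ => abs_nonneg (lam j)) (Finset.mem_univ j)]
  obtain ⟨hca, hcb, hcl⟩ := hc
  set X := spanProj w s * spanProj u t with hX
  set F : H →L[ℝ] H := diagOp w fun i => if i ∈ s then c + μ i else 0 with hF
  set G : H →L[ℝ] H := diagOp u fun j => if j ∈ t then c + lam j else 0 with hG
  set L : H →L[ℝ] H := diagOp w fun i => if i ∈ s then (c + μ i)⁻¹ else 0 with hL
  have hpos : ∀ i ∈ s, 0 < c + μ i := fun i hi => by linarith [ha i hi]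
  have h1 : X = L * (F * X) := by
    have : L * F = spanProj w s := by
      rw [hL, hF, diagOp_mul, spanProj]
      congr 1
      ext i
      by_cases hi : i ∈ s
      · simp [hi, (hpos i hi).ne']
      · simp [hi]
    rw [← mul_assoc, this, hX, ← mul_assoc, spanProj_mul_self]
  have h2 : F * X = spanProj w s * (diagOp w μ - diagOp u lam) * spanProj u t + X * G := by
    have e1 : F * spanProj w s =
        spanProj w s * diagOp w μ + diagOp w (fun _ => c) * spanProj w s := by
      rw [hF, spanProj, diagOp_mul, diagOp_mul, diagOp_mul, diagOp_add]
      congr 1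
      ext i
      by_cases hi : i ∈ s <;> simp [hi, add_comm]
    have e2 : spanProj u t * G =
        diagOp u lam * spanProj u t + spanProj u t * diagOp u (fun _ => c) := by
      rw [hG, spanProj, diagOp_mul, diagOp_mul, diagOp_mul, diagOp_add]
      congr 1
      ext i
      by_cases hi : i ∈ t <;> simp [hi, add_comm]
    have e3 : ∀ b : OrthonormalBasis ι ℝ H, diagOp b (fun _ => c) = c • (1 : H →L[ℝ] H) := fun b =>
      (eq_diagOp_of_apply b _ _ fun i => by simp).symm
    rw [hX, ← mul_assoc, e1, mul_assoc (spanProj w s) (spanProj u t) G, e2, e3, e3]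
    simp only [mul_add, add_mul, mul_sub, sub_mul, mul_assoc, smul_mul_assoc, mul_smul_comm,
      one_mul, mul_one]
    abel
  have h3 : ‖L‖ ≤ (c + a)⁻¹ := by
    refine norm_diagOp_le w (by positivity) fun i => ?_
    split_ifs with hi
    · rw [abs_of_pos (inv_pos.2 (hpos i hi))]
      exact inv_anti₀ hca (by linarith [ha i hi])
    · simp only [abs_zero]; positivity
  have h4 : ‖G‖ ≤ c + b := by
    refine norm_diagOp_le u hcb fun j => ?_
    split_ifs with hj
    · rw [abs_of_nonneg (hcl j)]
      linarith [hb j hj]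
    · simpa using hcb
  have h5 : ‖X‖ ≤ (c + a)⁻¹ * ‖F * X‖ := by
    calc ‖X‖ = ‖L * (F * X)‖ := by rw [← h1]
      _ ≤ ‖L‖ * ‖F * X‖ := norm_mul_le _ _
      _ ≤ _ := by gcongr
  have h6 : (c + a) * ‖X‖ ≤ ‖F * X‖ := by
    rwa [inv_mul_eq_div, le_div_iff₀' hca] at h5
  have h7 : ‖X * G‖ ≤ ‖X‖ * (c + b) := (norm_mul_le _ _).trans (by gcongr)
  have h8 : ‖F * X‖ ≤ _ := h2 ▸ norm_add_le _ _
  linarith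

end DiagOp

/-! ### The second-order expansion of an off-diagonal block. -/

section BlockBound

variable {𝔸 : Type*} [NormedRing 𝔸]

/-- A bound for the off-diagonal block `F * E * Q` in a ring with `1 = P + Q + N`, when the
operator is invertible on the range of `F` and `N` is annihilated by the unperturbed operator. -/
theorem norm_mul_mul_le_of_resolution {F L E P Q N : 𝔸} (hPQN : P + Q + N = 1)
    (hQQ : Q * Q = Q) (hLF : L * F = L) (hFN : F * N = L * E * N) (hF : ‖F‖ ≤ 1) (hQ : ‖Q‖ ≤ 1)
    (hN : ‖N‖ ≤ 1) {c e x y : ℝ} (hL : ‖L‖ ≤ c) (hE : ‖E‖ ≤ e) (hx1 : ‖P * E * Q‖ ≤ x)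
    (hx2 : ‖Q * E * Q‖ ≤ x) (hx3 : ‖(P + Q) * E * Q‖ ≤ x) (hy : ‖P * (E * E) * Q‖ ≤ y) :
    ‖F * E * Q‖ ≤ x + ‖F * Q‖ * x +
      c * (y + ‖F * Q‖ * e ^ 2 + c * e ^ 3 + e * x) := by
  have he : 0 ≤ e := (norm_nonneg _).trans hE
  have hc : 0 ≤ c := (norm_nonneg _).trans hL
  have hx : 0 ≤ x := (norm_nonneg _).trans hx1
  have split : ∀ T : 𝔸, F * T = F * P * T + F * Q * T + F * N * T := by
    intro T
    calc F * T = F * 1 * T := by rw [mul_one]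
      _ = _ := by rw [← hPQN]; noncomm_ring
  have hEE : ‖E * E‖ ≤ e ^ 2 := by
    rw [sq]; exact (norm_mul_le _ _).trans (by gcongr)
  have hLE : ‖L * E‖ ≤ c * e := (norm_mul_le _ _).trans (by gcongr)
  have hLEN : ‖L * E * N‖ ≤ c * e :=
    (norm_mul_le _ _).trans ((mul_le_of_le_one_right (norm_nonneg _) hN).trans hLE)
  -- The resolution is inserted a second time, now in front of `E * E`; this is where `y` enters.
  have b1 : ‖F * (E * E) * Q‖ ≤ y + ‖F * Q‖ * e ^ 2 + c * e ^ 3 := by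
    have e1 : F * (E * E) * Q =
        F * (P * (E * E) * Q) + F * Q * ((E * E) * Q) + L * E * N * ((E * E) * Q) := by
      rw [mul_assoc F, split, hFN]; noncomm_ring
    have hEEQ : ‖E * E * Q‖ ≤ e ^ 2 :=
      (norm_mul_le _ _).trans ((mul_le_of_le_one_right (norm_nonneg _) hQ).trans hEE)
    have t1 : ‖F * (P * (E * E) * Q)‖ ≤ y :=
      (norm_mul_le _ _).trans ((mul_le_of_le_one_left (norm_nonneg _) hF).trans hy)
    have t2 : ‖F * Q * ((E * E) * Q)‖ ≤ ‖F * Q‖ * e ^ 2 :=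
      (norm_mul_le _ _).trans (by gcongr)
    have t3 : ‖L * E * N * ((E * E) * Q)‖ ≤ c * e * e ^ 2 :=
      (norm_mul_le _ _).trans (by gcongr)
    rw [e1]
    refine (norm_add₃_le).trans ?_
    linarith
  have e2 : F * E * Q = F * (P * E * Q) + F * Q * (Q * E * Q) +
      (L * (F * (E * E) * Q) - L * E * ((P + Q) * E * Q)) := by
    -- Writing `N = 1 - (P + Q)` after `F * N = L * E * N` produces `L * E * E * Q`, and `L = L * F`
    -- brings back a leading `F` for `b1`.
    have e3 : F * N * (E * Q) = L * (F * (E * E) * Q) - L * E * ((P + Q) * E * Q) := by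
      have hN' : N = 1 - (P + Q) := by rw [← hPQN]; abel
      calc F * N * (E * Q) = L * E * (1 - (P + Q)) * (E * Q) := by rw [hFN, hN']
        _ = L * (E * E) * Q - L * E * ((P + Q) * E * Q) := by noncomm_ring
        _ = L * F * (E * E) * Q - L * E * ((P + Q) * E * Q) := by rw [hLF]
        _ = _ := by noncomm_ring
    have e4 : F * Q * (Q * E * Q) = F * Q * (E * Q) := by
      calc F * Q * (Q * E * Q) = F * (Q * Q) * (E * Q) := by noncomm_ring
        _ = _ := by rw [hQQ]
    rw [mul_assoc F E, split, e3, e4]; noncomm_ring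
  have t1 : ‖F * (P * E * Q)‖ ≤ x :=
    (norm_mul_le _ _).trans ((mul_le_of_le_one_left (norm_nonneg _) hF).trans hx1)
  have t2 : ‖F * Q * (Q * E * Q)‖ ≤ ‖F * Q‖ * x := (norm_mul_le _ _).trans (by gcongr)
  have t3 : ‖L * (F * (E * E) * Q)‖ ≤ c * (y + ‖F * Q‖ * e ^ 2 + c * e ^ 3) :=
    (norm_mul_le _ _).trans (by gcongr)
  have t4 : ‖L * E * ((P + Q) * E * Q)‖ ≤ c * e * x := (norm_mul_le _ _).trans (by gcongr)
  rw [e2]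
  refine (norm_add₃_le).trans ?_
  have t5 := norm_sub_le (L * (F * (E * E) * Q)) (L * E * ((P + Q) * E * Q))
  linarith

end BlockBound

/-! ### Locating the leading eigenvalues by min-max. -/

section Location

variable {ι H : Type*} [Fintype ι] [DecidableEq ι] [NormedAddCommGroup H] [InnerProductSpace ℝ H]

theorem abs_inner_apply_le (T : H →L[ℝ] H) {c : ℝ} (hT : ‖T‖ ≤ c) (v w : H) :
    |inner ℝ v (T w)| ≤ c * ‖v‖ * ‖w‖ := by
  calc |inner ℝ v (T w)| ≤ ‖v‖ * ‖T w‖ := abs_real_inner_le_norm _ _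
    _ ≤ ‖v‖ * (c * ‖w‖) := by
        gcongr
        exact ContinuousLinearMap.le_of_opNorm_le _ hT w
    _ = c * ‖v‖ * ‖w‖ := by ring

/-- Localization of the leading eigenvalues of a perturbed operator. -/
theorem eigenvalue_location (u w : OrthonormalBasis ι ℝ H) (lam μ : ι → ℝ) (s : Finset ι)
    {α σ σ' e x : ℝ} (hσ' : 0 ≤ σ') (hσ : σ' < σ) (hα : σ ≤ α)
    (hs : ∀ i ∈ s, α ≤ lam i) (hs' : ∀ i ∉ s, lam i ≤ σ')
    (hE : ‖diagOp w μ - diagOp u lam‖ ≤ e)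
    (hU : ‖spanProj u (Finset.univ.filter fun i => lam i ≠ 0) * (diagOp w μ - diagOp u lam) *
      spanProj u (Finset.univ.filter fun i => lam i ≠ 0)‖ ≤ x)
    (hx : x ≤ (σ - σ') / 24) (he : e ≤ σ / 24) (he2 : e ^ 2 ≤ σ * (σ - σ') / 576) :
    (∀ i, (σ + σ') / 2 < μ i → α - x ≤ μ i) ∧
      (Finset.univ.filter fun i => (σ + σ') / 2 < μ i).card = s.card := by
  set E := diagOp w μ - diagOp u lam with hEdef
  set Z := Finset.univ.filter fun i => lam i ≠ 0 with hZ
  set U := spanProj u Z with hUdef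
  have he0 : 0 ≤ e := (norm_nonneg _).trans hE
  have hx0 : 0 ≤ x := (norm_nonneg _).trans hU
  have hM : ∀ v, inner ℝ v (diagOp w μ v) = inner ℝ v (diagOp u lam v) + inner ℝ v (E v) := by
    intro v
    rw [← inner_add_right, hEdef, sub_apply]
    congr 1
    abel
  have hUU : ∀ v, |inner ℝ (U v) (E (U v))| ≤ x * ‖U v‖ ^ 2 := by
    intro v
    have h1 : U (U v) = U v := by
      rw [← mul_apply_eq_comp, hUdef, spanProj_mul_self]
    have h2 : inner ℝ (U v) (E (U v)) = inner ℝ (U v) ((U * E * U) (U v)) := by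
      calc inner ℝ (U v) (E (U v)) = inner ℝ (U (U v)) (E (U (U v))) := by rw [h1]
        _ = inner ℝ (U v) (U (E (U (U v)))) := inner_diagOp_comm _ _ _ _
        _ = _ := rfl
    rw [h2, sq, ← mul_assoc]
    exact abs_inner_apply_le _ hU _ _
  -- On the span of the `u i` with `i ∈ s` all eigenvalues are nonzero, so `E` acts only through its
  -- compression and costs `x` instead of `e`.
  have low : s.card ≤ (Finset.univ.filter fun i => α - x ≤ μ i).card := by
    refine card_le_card_filter_le u w μ s _ fun v hv => ?_
    have hc : ∀ i ∉ s, inner ℝ (u i) v = 0 := by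
      intro i hi
      rw [← hv, inner_spanProj, if_neg hi]
    have hUv : U v = v := by
      refine u.ext_inner fun i => ?_
      rw [hUdef, inner_spanProj]
      split_ifs with hi
      · rfl
      · refine (hc i fun his => hi ?_).symm
        simp only [hZ, Finset.mem_filter, Finset.mem_univ, true_and]
        have := hs i his
        intro h0
        linarith
    have h1 : α * ‖v‖ ^ 2 ≤ inner ℝ v (diagOp u lam v) := by
      rw [inner_diagOp_self, u.norm_sq_eq_sum, Finset.mul_sum]
      refine Finset.sum_le_sum fun i _ => ?_
      by_cases hi : i ∈ s
      · exact mul_le_mul_of_nonneg_right (hs i hi) (sq_nonneg _)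
      · simp [hc i hi]
    have h2 := (abs_le.1 (hUU v)).1
    rw [hUv] at h2
    rw [hM]
    linarith
  have high : sᶜ.card ≤ (Finset.univ.filter fun i => -((σ + σ') / 2) ≤ (-μ) i).card := by
    refine card_le_card_filter_le u w (-μ) sᶜ _ fun v hv => ?_
    rw [← diagOp_neg, neg_apply, inner_neg_right, hM]
    have hc : ∀ i ∈ s, inner ℝ (u i) v = 0 := by
      intro i hi
      rw [← hv, inner_spanProj, if_neg (by simpa using hi)]
    -- The part `a` in the support of `lam` sees `E` through `x`; the part `b` in the kernel has no
    -- `σ'` contribution and can afford `e`.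
    set a := U v with ha
    set b := v - U v with hb
    have hab : v = a + b := by rw [ha, hb]; abel
    have hbi : ∀ i, inner ℝ (u i) b = if i ∈ Z then 0 else inner ℝ (u i) v := by
      intro i
      rw [hb, inner_sub_right, hUdef, inner_spanProj]
      split_ifs <;> simp
    have hpyth : ‖v‖ ^ 2 = ‖a‖ ^ 2 + ‖b‖ ^ 2 := by
      rw [u.norm_sq_eq_sum, u.norm_sq_eq_sum, u.norm_sq_eq_sum b, ← Finset.sum_add_distrib]
      refine Finset.sum_congr rfl fun i _ => ?_
      rw [hbi, ha, hUdef, inner_spanProj]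
      split_ifs <;> simp
    have h1 : inner ℝ v (diagOp u lam v) ≤ σ' * ‖a‖ ^ 2 := by
      rw [inner_diagOp_self, u.norm_sq_eq_sum, Finset.mul_sum]
      refine Finset.sum_le_sum fun i _ => ?_
      rw [ha, hUdef, inner_spanProj]
      by_cases hi : i ∈ s
      · simp [hc i hi]
      · split_ifs with hz
        · exact mul_le_mul_of_nonneg_right (hs' i hi) (sq_nonneg _)
        · have : lam i = 0 := by simpa [hZ] using hz
          simp [this]
    have h2 : inner ℝ v (E v) ≤ x * ‖a‖ ^ 2 + 2 * (e * ‖a‖ * ‖b‖) + e * ‖b‖ ^ 2 := by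
      have t1 := (abs_le.1 (hUU v)).2
      have t2 := (abs_le.1 (abs_inner_apply_le E hE a b)).2
      have t3 := (abs_le.1 (abs_inner_apply_le E hE b a)).2
      have t4 := (abs_le.1 (abs_inner_apply_le E hE b b)).2
      have : inner ℝ v (E v) =
          inner ℝ a (E a) + inner ℝ a (E b) + (inner ℝ b (E a) + inner ℝ b (E b)) := by
        rw [hab, map_add, inner_add_left, inner_add_right, inner_add_right]
      rw [this]
      nlinarith
    -- Arithmetic-geometric mean: the bound on `e ^ 2` is the product of the weights `(σ - σ') / 24`
    -- and `σ / 24`.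
    have h3 : 2 * (e * ‖a‖ * ‖b‖) ≤
        (σ - σ') / 24 * ‖a‖ ^ 2 + σ / 24 * ‖b‖ ^ 2 := by
      have h4 : (e * ‖a‖ * ‖b‖) ^ 2 ≤ ((σ - σ') / 24 * ‖a‖ ^ 2) * (σ / 24 * ‖b‖ ^ 2) := by
        have := mul_le_mul_of_nonneg_right he2 (by positivity : 0 ≤ ‖a‖ ^ 2 * ‖b‖ ^ 2)
        nlinarith
      have p1 : 0 ≤ (σ - σ') / 24 * ‖a‖ ^ 2 := by
        have : 0 ≤ σ - σ' := by linarith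
        positivity
      have p2 : 0 ≤ σ / 24 * ‖b‖ ^ 2 := by
        have : 0 ≤ σ := by linarith
        positivity
      refine le_of_sq_le_sq ?_ (by positivity)
      nlinarith [sq_nonneg ((σ - σ') / 24 * ‖a‖ ^ 2 - σ / 24 * ‖b‖ ^ 2)]
    have h5 : x * ‖a‖ ^ 2 ≤ (σ - σ') / 24 * ‖a‖ ^ 2 := by gcongr
    have h6 : e * ‖b‖ ^ 2 ≤ σ / 24 * ‖b‖ ^ 2 := by gcongr
    have h7 : 0 ≤ (σ - σ') * ‖a‖ ^ 2 := mul_nonneg (by linarith) (sq_nonneg _)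
    have h8 : 0 ≤ σ * ‖b‖ ^ 2 := mul_nonneg (by linarith) (sq_nonneg _)
    have h9 : 0 ≤ σ' * ‖b‖ ^ 2 := mul_nonneg (by linarith) (sq_nonneg _)
    rw [hpyth]
    nlinarith
  have hsub : (Finset.univ.filter fun i => α - x ≤ μ i) ⊆
      Finset.univ.filter fun i => (σ + σ') / 2 < μ i := by
    intro i
    simp only [Finset.mem_filter, Finset.mem_univ, true_and]
    intro h
    linarith
  have hle : (Finset.univ.filter fun i => (σ + σ') / 2 < μ i).card ≤ s.card := by
    have h1 : (Finset.univ.filter fun i => -((σ + σ') / 2) ≤ (-μ) i) =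
        (Finset.univ.filter fun i => (σ + σ') / 2 < μ i)ᶜ := by
      ext i
      simp
    rw [h1, Finset.card_compl, Finset.card_compl] at high
    have := Finset.card_le_univ (Finset.univ.filter fun i => (σ + σ') / 2 < μ i)
    have := Finset.card_le_univ s
    omega
  -- At least `s.card` eigenvalues reach `α - x`, at most `s.card` exceed the midpoint, and the
  -- first set lies in the second, so no eigenvalue lies in between.
  have heq := Finset.eq_of_subset_of_card_le hsub (hle.trans low)
  refine ⟨fun i hi => ?_, le_antisymm hle (heq ▸ low)⟩
  have : i ∈ Finset.univ.filter fun i => α - x ≤ μ i := by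
    rw [heq]; simpa using hi
  simpa using this

end Location

/-! ### Perturbation of the leading spectral part of a symmetric operator. -/

section Core

variable {ι H : Type*} [DecidableEq ι] [NormedAddCommGroup H] [InnerProductSpace ℝ H]

/-- The spectral data of the unperturbed operator: the eigenvalues indexed by `s` are at least
`α`, those indexed by `t` are at most `-β`, and the remaining ones are at most `σ'` in absolute
value and at distance at least `d` from `α` and `-β`. -/
structure SplitSpectrum (lam : ι → ℝ) (s t : Finset ι) (α β σ σ' d : ℝ) : Prop where
  nonneg : 0 ≤ σ'
  lt : σ' < σ
  le_left : σ ≤ α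
  le_right : σ ≤ β
  gap_le : σ - σ' ≤ d
  left : ∀ i ∈ s, α ≤ lam i
  right : ∀ i ∈ t, lam i ≤ -β
  rest_abs : ∀ i ∉ s ∪ t, |lam i| ≤ σ'
  rest_left : ∀ i ∉ s ∪ t, lam i ≤ α - d
  rest_right : ∀ i ∉ s ∪ t, -lam i ≤ β - d

/-- Together with `PerturbationBounds.neg`, this reduces statements about the leading negative
eigenvalues to the positive ones. -/
theorem SplitSpectrum.neg {lam : ι → ℝ} {s t : Finset ι} {α β σ σ' d : ℝ}
    (h : SplitSpectrum lam s t α β σ σ' d) : SplitSpectrum (-lam) t s β α σ σ' d where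
  nonneg := h.nonneg
  lt := h.lt
  le_left := h.le_right
  le_right := h.le_left
  gap_le := h.gap_le
  left i hi := by have := h.right i hi; simp only [Pi.neg_apply]; linarith
  right i hi := by have := h.left i hi; simp only [Pi.neg_apply]; linarith
  rest_abs i hi := by rw [Pi.neg_apply, abs_neg]; exact h.rest_abs i (by rwa [Finset.union_comm])
  rest_left i hi := h.rest_right i (by rwa [Finset.union_comm])
  rest_right i hi := by
    have := h.rest_left i (by rwa [Finset.union_comm])
    simpa using this

theorem SplitSpectrum.disjoint {lam : ι → ℝ} {s t : Finset ι} {α β σ σ' d : ℝ}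
    (h : SplitSpectrum lam s t α β σ σ' d) : Disjoint s t := by
  rw [Finset.disjoint_left]
  intro i hs ht
  linarith [h.nonneg, h.lt, h.le_left, h.le_right, h.left i hs, h.right i ht]

variable [Fintype ι]

/-- The smallness and skewness assumptions on the perturbation of `∑ i, lam i • u i (u i)ᵀ` to
`∑ i, μ i • w i (w i)ᵀ`. -/
structure PerturbationBounds (u w : OrthonormalBasis ι ℝ H) (lam μ : ι → ℝ) (s t : Finset ι)
    (σ σ' e x y : ℝ) : Prop where
  norm_le : ‖diagOp w μ - diagOp u lam‖ ≤ e
  compression_le : ‖spanProj u (Finset.univ.filter fun i => lam i ≠ 0) *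
    (diagOp w μ - diagOp u lam) * spanProj u (Finset.univ.filter fun i => lam i ≠ 0)‖ ≤ x
  sq_le : ‖spanProj u (s ∪ t) *
    ((diagOp w μ - diagOp u lam) * (diagOp w μ - diagOp u lam)) *
      spanProj u ((Finset.univ.filter fun i => lam i ≠ 0) \ (s ∪ t))‖ ≤ y
  x_le : x ≤ (σ - σ') / 24
  e_le : e ≤ σ / 24
  e_sq_le : e ^ 2 ≤ σ * (σ - σ') / 576

theorem PerturbationBounds.neg {u w : OrthonormalBasis ι ℝ H} {lam μ : ι → ℝ} {s t : Finset ι}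
    {σ σ' e x y : ℝ} (h : PerturbationBounds u w lam μ s t σ σ' e x y) :
    PerturbationBounds u w (-lam) (-μ) t s σ σ' e x y := by
  have h1 : diagOp w (-μ) - diagOp u (-lam) = -(diagOp w μ - diagOp u lam) := by
    rw [← diagOp_neg, ← diagOp_neg]; abel
  constructor
  · rw [h1, norm_neg]; exact h.norm_le
  · rw [h1]
    simpa only [Pi.neg_apply, ne_eq, neg_eq_zero, mul_neg, neg_mul, norm_neg] using
      h.compression_le
  · rw [h1, Finset.union_comm]
    simpa only [Pi.neg_apply, ne_eq, neg_eq_zero, neg_mul_neg] using h.sq_le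
  · exact h.x_le
  · exact h.e_le
  · exact h.e_sq_le

theorem SplitSpectrum.union_subset {lam : ι → ℝ} {s t : Finset ι} {α β σ σ' d : ℝ}
    (h : SplitSpectrum lam s t α β σ σ' d) :
    s ∪ t ⊆ Finset.univ.filter fun i => lam i ≠ 0 := by
  intro i hi
  simp only [Finset.mem_filter, Finset.mem_univ, true_and]
  intro h0
  rcases Finset.mem_union.1 hi with hi | hi
  · linarith [h.nonneg, h.lt, h.le_left, h.le_right, h.left i hi]
  · linarith [h.nonneg, h.lt, h.le_left, h.le_right, h.right i hi]

theorem SplitSpectrum.card_filter {u w : OrthonormalBasis ι ℝ H} {lam μ : ι → ℝ} {s t : Finset ι}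
    {α β σ σ' d e x y : ℝ} (hs : SplitSpectrum lam s t α β σ σ' d)
    (hp : PerturbationBounds u w lam μ s t σ σ' e x y) :
    (∀ i, (σ + σ') / 2 < μ i → α - x ≤ μ i) ∧
      (Finset.univ.filter fun i => (σ + σ') / 2 < μ i).card = s.card := by
  refine eigenvalue_location u w lam μ s hs.nonneg hs.lt hs.le_left hs.left (fun i hi => ?_)
    hp.norm_le hp.compression_le hp.x_le hp.e_le hp.e_sq_le
  by_cases ht : i ∈ t
  · linarith [hs.right i ht, hs.le_right, hs.nonneg, hs.lt]
  · exact (le_abs_self _).trans (hs.rest_abs i (by simp [hi, ht]))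

/-! ### Block estimates for the perturbed projection. -/

section Blocks

variable {u w : OrthonormalBasis ι ℝ H} {lam μ : ι → ℝ} {s t : Finset ι}
    {α β σ σ' d e x y : ℝ}

theorem diagOp_inv_mul (w : OrthonormalBasis ι ℝ H) {μ : ι → ℝ} {J : Finset ι}
    (h0 : ∀ i ∈ J, μ i ≠ 0) :
    diagOp w (fun i => if i ∈ J then (μ i)⁻¹ else 0) * diagOp w μ = spanProj w J := by
  rw [diagOp_mul, spanProj]
  congr 1
  ext i
  by_cases hi : i ∈ J
  · simp [hi, h0 i hi]
  · simp [hi]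

theorem diagOp_inv_mul_spanProj (w : OrthonormalBasis ι ℝ H) (μ : ι → ℝ) (J : Finset ι) :
    diagOp w (fun i => if i ∈ J then (μ i)⁻¹ else 0) * spanProj w J =
      diagOp w (fun i => if i ∈ J then (μ i)⁻¹ else 0) := by
  rw [spanProj, diagOp_mul]
  congr 1
  ext i
  by_cases hi : i ∈ J <;> simp [hi]

theorem diagOp_mul_spanProj_compl_support (u : OrthonormalBasis ι ℝ H) (lam : ι → ℝ) :
    diagOp u lam * spanProj u (Finset.univ.filter fun i => lam i ≠ 0)ᶜ = 0 := by
  rw [spanProj, diagOp_mul]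
  refine (eq_diagOp_of_apply u _ _ fun i => ?_).symm
  by_cases hi : lam i = 0 <;> simp [hi]

theorem norm_diagOp_inv_le (w : OrthonormalBasis ι ℝ H) {μ : ι → ℝ} {J : Finset ι} {c : ℝ}
    (hc : 0 < c) (h : ∀ i ∈ J, c ≤ |μ i|) :
    ‖diagOp w (fun i => if i ∈ J then (μ i)⁻¹ else 0)‖ ≤ c⁻¹ := by
  refine norm_diagOp_le w (by positivity) fun i => ?_
  split_ifs with hi
  · rw [abs_inv]
    exact inv_anti₀ hc (h i hi)
  · simp only [abs_zero]; positivity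

/-- The unperturbed operator vanishes on its kernel, so there the perturbed operator equals the
perturbation; inverting the former on the `J`-eigenvectors gives a factor of size e/σ. -/
theorem spanProj_mul_compl_support (u w : OrthonormalBasis ι ℝ H) (lam : ι → ℝ) {μ : ι → ℝ}
    {J : Finset ι} (h0 : ∀ i ∈ J, μ i ≠ 0) :
    spanProj w J * spanProj u (Finset.univ.filter fun i => lam i ≠ 0)ᶜ =
      diagOp w (fun i => if i ∈ J then (μ i)⁻¹ else 0) * (diagOp w μ - diagOp u lam) *
        spanProj u (Finset.univ.filter fun i => lam i ≠ 0)ᶜ := by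
  rw [mul_sub, sub_mul, diagOp_inv_mul w h0, mul_assoc _ (diagOp u lam),
    diagOp_mul_spanProj_compl_support, mul_zero, sub_zero]

theorem spanProj_resolution (u : OrthonormalBasis ι ℝ H) {a b : Finset ι} (h : a ⊆ b) :
    spanProj u a + spanProj u (b \ a) + spanProj u bᶜ = 1 := by
  rw [← spanProj_union u Finset.disjoint_sdiff, Finset.union_sdiff_of_subset h, spanProj_compl]
  abel

theorem spanProj_mul_of_subset (u : OrthonormalBasis ι ℝ H) {a b : Finset ι} (h : a ⊆ b) :
    spanProj u a * spanProj u b = spanProj u a ∧ spanProj u b * spanProj u a = spanProj u a := by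
  constructor
  · rw [spanProj, spanProj, diagOp_mul]
    congr 1
    ext i
    by_cases hi : i ∈ a
    · simp [hi, h hi]
    · simp [hi]
  · rw [spanProj, spanProj, diagOp_mul]
    congr 1
    ext i
    by_cases hi : i ∈ a
    · simp [hi, h hi]
    · simp [hi]

theorem norm_compression_mono (u : OrthonormalBasis ι ℝ H) (T : H →L[ℝ] H) {a b c : Finset ι}
    (ha : a ⊆ c) (hb : b ⊆ c) :
    ‖spanProj u a * T * spanProj u b‖ ≤ ‖spanProj u c * T * spanProj u c‖ := by
  have h : spanProj u a * T * spanProj u b =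
      spanProj u a * (spanProj u c * T * spanProj u c) * spanProj u b := by
    calc spanProj u a * T * spanProj u b
        = (spanProj u a * spanProj u c) * T * (spanProj u c * spanProj u b) := by
          rw [(spanProj_mul_of_subset u ha).1, (spanProj_mul_of_subset u hb).2]
      _ = _ := by noncomm_ring
  rw [h]
  refine (norm_mul_le _ _).trans ((mul_le_of_le_one_right (norm_nonneg _)
    (norm_spanProj_le _ _)).trans ?_)
  exact (norm_mul_le _ _).trans (mul_le_of_le_one_left (norm_nonneg _) (norm_spanProj_le _ _))

/-- The leading positive eigenspace of the perturbed operator is almost orthogonal to the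
remaining eigenvectors of nonzero eigenvalues. -/
theorem SplitSpectrum.norm_spanProj_mul_le (hs : SplitSpectrum lam s t α β σ σ' d)
    (hp : PerturbationBounds u w lam μ s t σ σ' e x y) (hy : 0 ≤ y) :
    σ * ‖spanProj w (Finset.univ.filter fun i => (σ + σ') / 2 < μ i) *
      spanProj u ((Finset.univ.filter fun i => lam i ≠ 0) \ (s ∪ t))‖ ≤
      23 / 20 * (σ * x / d + y / d) + e / 400 := by
  obtain ⟨hJ, -⟩ := hs.card_filter hp
  set J := Finset.univ.filter fun i => (σ + σ') / 2 < μ i with hJdef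
  set Z := Finset.univ.filter fun i => lam i ≠ 0 with hZ
  have hσ : 0 < σ := hs.nonneg.trans_lt hs.lt
  have hd : 0 < d := by linarith [hs.lt, hs.gap_le]
  have he : 0 ≤ e := (norm_nonneg _).trans hp.norm_le
  have hx : 0 ≤ x := (norm_nonneg _).trans hp.compression_le
  have hxd := hp.x_le
  have hJ' : ∀ i ∈ J, α - x ≤ μ i := fun i hi => hJ i (by simpa [hJdef] using hi)
  have hμ : ∀ i ∈ J, 23 / 24 * σ ≤ μ i := fun i hi => by
    linarith [hJ' i hi, hs.le_left, hs.nonneg]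
  have gap := gap_mul_norm_le u w lam μ J (Z \ (s ∪ t)) (a := α - x) (b := α - d) hJ'
    fun j hj => hs.rest_left j (Finset.mem_sdiff.1 hj).2
  have hL := norm_diagOp_inv_le w (μ := μ) (J := J) (c := 23 / 24 * σ) (by positivity)
    fun i hi => (hμ i hi).trans (le_abs_self _)
  have block := norm_mul_mul_le_of_resolution
    (spanProj_resolution u hs.union_subset) (spanProj_mul_self u (Z \ (s ∪ t)))
    (diagOp_inv_mul_spanProj w μ J)
    (spanProj_mul_compl_support u w lam fun i hi =>
      (lt_of_lt_of_le (by positivity) (hμ i hi)).ne')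
    (norm_spanProj_le w J) (norm_spanProj_le u _) (norm_spanProj_le u _) hL hp.norm_le
    ((norm_compression_mono u _ hs.union_subset Finset.sdiff_subset).trans hp.compression_le)
    ((norm_compression_mono u _ Finset.sdiff_subset Finset.sdiff_subset).trans hp.compression_le)
    (by
      rw [← spanProj_union u Finset.disjoint_sdiff, Finset.union_sdiff_of_subset hs.union_subset]
      exact (norm_compression_mono u _ (subset_refl _) Finset.sdiff_subset).trans
        hp.compression_le) hp.sq_le
  set X := ‖spanProj w J * spanProj u (Z \ (s ∪ t))‖ with hX
  have hX0 : 0 ≤ X := norm_nonneg _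
  have main := gap.trans block
  set c := (23 / 24 * σ)⁻¹ with hc
  have hcσ : c * σ = 24 / 23 := by rw [hc]; field_simp
  have hc0 : 0 < c := by positivity
  have hce : c * e ≤ 1 / 23 := by
    calc c * e ≤ c * (σ / 24) := by gcongr; exact hp.e_le
      _ = c * σ / 24 := by ring
      _ = 1 / 23 := by rw [hcσ]; norm_num
  have hce2 : c * e ^ 2 ≤ d / 552 := by
    calc c * e ^ 2 ≤ c * (σ * (σ - σ') / 576) := by gcongr; exact hp.e_sq_le
      _ = c * σ * (σ - σ') / 576 := by ring
      _ = (σ - σ') / 552 := by rw [hcσ]; ring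
      _ ≤ d / 552 := by gcongr; exact hs.gap_le
  have hxd' : x ≤ d / 24 := by linarith [hs.gap_le]
  have a1 : c * (c * e ^ 3) ≤ d / 552 * (c * e) := by
    calc c * (c * e ^ 3) = (c * e ^ 2) * (c * e) := by ring
      _ ≤ _ := by gcongr
  have a2 : X * (c * e ^ 2) ≤ X * (d / 552) := by gcongr
  have a3 : X * x ≤ X * (d / 24) := by gcongr
  have a4 : c * e * x ≤ 1 / 23 * x := by gcongr
  -- The terms with `X` move to the left: `2 * x ≤ d / 12` from the Sylvester gap and the block `Q *
  -- E * Q`, and `c * e ^ 2 ≤ d / 552`.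
  have m1 : X * d * (22 / 24 - 1 / 552) ≤ 24 / 23 * x + c * y + d / 552 * (c * e) := by
    nlinarith
  have m2 : X * d * (22 / 24 - 1 / 552) * σ ≤ (24 / 23 * x + c * y + d / 552 * (c * e)) * σ := by
    gcongr
  have m3 : (24 / 23 * x + c * y + d / 552 * (c * e)) * σ =
      24 / 23 * (σ * x + y) + d * e / 529 := by
    calc _ = 24 / 23 * (σ * x) + (c * σ) * y + d / 552 * ((c * σ) * e) := by ring
      _ = _ := by rw [hcσ]; ring
  have m4 : σ * X * d ≤ 23 / 20 * (σ * x + y) + e / 400 * d := by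
    have : 0 ≤ σ * x + y := by positivity
    have : 0 ≤ d * e := by positivity
    nlinarith
  have m5 : 23 / 20 * (σ * x / d + y / d) + e / 400 =
      (23 / 20 * (σ * x + y) + e / 400 * d) / d := by
    field_simp
  rw [m5, le_div_iff₀ hd]
  exact m4

/-- Perturbation bound for the part of a symmetric operator on its leading eigenvectors. -/
theorem SplitSpectrum.norm_sub_le [CompleteSpace H] (hs : SplitSpectrum lam s t α β σ σ' d)
    (hp : PerturbationBounds u w lam μ s t σ σ' e x y) (hy : 0 ≤ y) :
    ∃ J : Finset ι, J.card = (s ∪ t).card ∧ (∀ i ∈ J, (3 * σ + σ') / 4 < |μ i|) ∧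
      (∀ i ∉ J, |μ i| < (3 * σ + σ') / 4) ∧
      ‖diagOp w μ * spanProj w J - diagOp u lam * spanProj u (s ∪ t)‖ ≤
        8 * (e + σ * x / d + y / d) := by
  obtain ⟨hJ1, hc1⟩ := hs.card_filter hp
  obtain ⟨hJ2, hc2⟩ := hs.neg.card_filter hp.neg
  have X1 := hs.norm_spanProj_mul_le hp hy
  have X2 := hs.neg.norm_spanProj_mul_le hp.neg hy
  have hZneg : (Finset.univ.filter fun i => (-lam) i ≠ 0) = Finset.univ.filter fun i => lam i ≠ 0 := by
    ext i; simp
  rw [hZneg, Finset.union_comm t s] at X2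
  set Z := Finset.univ.filter fun i => lam i ≠ 0 with hZ
  set J1 := Finset.univ.filter fun i => (σ + σ') / 2 < μ i with hJ1def
  set J2 := Finset.univ.filter fun i => (σ + σ') / 2 < (-μ) i with hJ2def
  have hσ : 0 < σ := hs.nonneg.trans_lt hs.lt
  have hd : 0 < d := by linarith [hs.lt, hs.gap_le]
  have he : 0 ≤ e := (norm_nonneg _).trans hp.norm_le
  have hx : 0 ≤ x := (norm_nonneg _).trans hp.compression_le
  have hxd := hp.x_le
  have hdisj : Disjoint J1 J2 := by
    rw [Finset.disjoint_left]
    intro i h1 h2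
    simp only [hJ1def, hJ2def, Finset.mem_filter, Finset.mem_univ, true_and, Pi.neg_apply] at h1 h2
    linarith [hs.nonneg]
  have hin : ∀ i ∈ J1 ∪ J2, σ - x ≤ |μ i| := by
    intro i hi
    rcases Finset.mem_union.1 hi with hi | hi
    · have := hJ1 i (by simpa [hJ1def] using hi)
      linarith [le_abs_self (μ i), hs.le_left]
    · have := hJ2 i (by simpa [hJ2def] using hi)
      simp only [Pi.neg_apply] at this
      linarith [neg_le_abs (μ i), hs.le_right]
  have hout : ∀ i ∉ J1 ∪ J2, |μ i| ≤ (σ + σ') / 2 := by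
    intro i hi
    simp only [hJ1def, hJ2def, Finset.mem_union, Finset.mem_filter, Finset.mem_univ, true_and,
      Pi.neg_apply, not_or, not_lt] at hi
    rw [abs_le]
    constructor <;> linarith
  have hcard : (J1 ∪ J2).card = (s ∪ t).card := by
    rw [Finset.card_union_of_disjoint hdisj, Finset.card_union_of_disjoint hs.disjoint, hc1, hc2]
  refine ⟨J1 ∪ J2, hcard, fun i hi => ?_, fun i hi => ?_, ?_⟩
  · linarith [hin i hi, hs.lt]
  · linarith [hout i hi, hs.lt]
  set J := J1 ∪ J2 with hJdef
  set R := spanProj w J with hR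
  set P := spanProj u (s ∪ t) with hP
  set Q := spanProj u (Z \ (s ∪ t)) with hQ
  set N := spanProj u Zᶜ with hN
  set A := diagOp u lam with hA
  set M := diagOp w μ with hM
  set E := M - A with hE
  have hres : P + Q + N = 1 := spanProj_resolution u hs.union_subset
  have h1P : 1 - P = Q + N := by rw [← hres]; abel
  have nR : ‖R‖ ≤ 1 := norm_spanProj_le _ _
  have nP : ‖P‖ ≤ 1 := norm_spanProj_le _ _
  have nN : ‖N‖ ≤ 1 := norm_spanProj_le _ _
  have n1P : ‖1 - P‖ ≤ 1 := by rw [hP, ← spanProj_compl]; exact norm_spanProj_le _ _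
  have nE : ‖E‖ ≤ e := hp.norm_le
  -- The two signs are treated separately because the Sylvester bound needs spectra separated by a
  -- line.
  have hRQ : σ * ‖R * Q‖ ≤ 23 / 10 * (σ * x / d + y / d) + e / 200 := by
    have h1 : ‖R * Q‖ ≤ ‖spanProj w J1 * Q‖ + ‖spanProj w J2 * Q‖ := by
      rw [hR, hJdef, spanProj_union w hdisj, add_mul]
      exact norm_add_le _ _
    have h2 := mul_le_mul_of_nonneg_left h1 hσ.le
    linarith
  have hRN : σ * ‖R * N‖ ≤ 24 / 23 * e := by
    have hμ : ∀ i ∈ J, 23 / 24 * σ ≤ |μ i| := fun i hi => by linarith [hin i hi, hs.nonneg]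
    have h1 := norm_diagOp_inv_le w (μ := μ) (J := J) (c := 23 / 24 * σ) (by positivity) hμ
    have hμ0 : ∀ i ∈ J, μ i ≠ 0 := fun i hi =>
      abs_pos.1 (lt_of_lt_of_le (by positivity) (hμ i hi))
    have h2 : ‖R * N‖ ≤ (23 / 24 * σ)⁻¹ * e := by
      rw [hR, hN, spanProj_mul_compl_support u w lam hμ0]
      refine (norm_mul_le _ _).trans ((mul_le_of_le_one_right (norm_nonneg _) nN).trans ?_)
      exact (norm_mul_le _ _).trans (by gcongr)
    calc σ * ‖R * N‖ ≤ σ * ((23 / 24 * σ)⁻¹ * e) := by gcongr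
      _ = 24 / 23 * e := by field_simp
  have hMR : M * R = R * M := by rw [hM, hR, spanProj, diagOp_mul, diagOp_mul, mul_comm]
  have hAP : A * P = P * A := by rw [hA, hP, spanProj, diagOp_mul, diagOp_mul, mul_comm]
  have hPP : P * P = P := spanProj_mul_self _ _
  have hRR : R * R = R := spanProj_mul_self _ _
  -- the block of the perturbed part from the trailing to all eigenvectors
  have b1 : ‖M * R * (1 - P)‖ ≤ σ * ‖R * Q‖ + e := by
    have hAQ : A * (1 - P) = Q * (A * (1 - P)) ∧ ‖A * (1 - P)‖ ≤ σ := by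
      have h1 : A * (1 - P) = diagOp u fun i => if i ∈ s ∪ t then 0 else lam i := by
        rw [hP, ← spanProj_compl, spanProj, diagOp_mul]
        congr 1
        ext i
        by_cases hi : i ∈ s ∪ t <;> simp [-Finset.mem_union, -Finset.compl_union, hi]
      rw [h1]
      constructor
      · rw [hQ, spanProj, diagOp_mul]
        congr 1
        ext i
        by_cases hi : i ∈ s ∪ t
        · simp [-Finset.mem_union, hi]
        · by_cases h0 : lam i = 0 <;> simp [-Finset.mem_union, hi, hZ, h0]
      · refine norm_diagOp_le u hσ.le fun i => ?_
        split_ifs with hi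
        · simpa using hσ.le
        · exact (hs.rest_abs i hi).trans hs.lt.le
    -- `R` commutes with `M = A + E`, and `A * (1 - P)` has range in that of `Q`, so the kernel of
    -- `A` contributes only through `E`.
    have h2 : M * R * (1 - P) = R * Q * (A * (1 - P)) + R * E * (1 - P) := by
      rw [mul_assoc R Q, ← hAQ.1, hMR, hE]; noncomm_ring
    rw [h2]
    refine (norm_add_le _ _).trans (add_le_add ?_ ?_)
    · rw [mul_comm σ]
      exact (norm_mul_le _ _).trans (by gcongr; exact hAQ.2)
    · refine (norm_mul_le _ _).trans ((mul_le_of_le_one_right (norm_nonneg _) n1P).trans ?_)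
      exact (norm_mul_le _ _).trans ((mul_le_of_le_one_left (norm_nonneg _) nR).trans nE)
  have b2 : ‖(1 - P) * (M * R) * P‖ ≤ σ * ‖R * Q‖ + e := by
    refine (norm_mul_le _ _).trans ((mul_le_of_le_one_right (norm_nonneg _) nP).trans ?_)
    have : ‖(1 - P) * (M * R)‖ = ‖M * R * (1 - P)‖ := by
      rw [← norm_star (M * R * (1 - P)), star_mul, star_mul, star_sub, star_one, hP, hR, hM,
        spanProj, spanProj, star_diagOp, star_diagOp, star_diagOp]
      simp only [diagOp_mul, mul_comm]
    rw [this]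
    exact b1
  have b3 : ‖P * (M * (1 - R)) * P‖ ≤ σ * ‖R * Q‖ + 24 / 23 * e := by
    have h1 : P * (M * (1 - R)) * P = P * (M * (1 - R)) * ((1 - R) * P) := by
      have : (1 - R) * (1 - R) = 1 - R := by
        rw [mul_sub, sub_mul (1 : H →L[ℝ] H) R R, hRR]; simp
      calc P * (M * (1 - R)) * P = P * (M * ((1 - R) * (1 - R))) * P := by rw [this]
        _ = _ := by noncomm_ring
    have h2 : ‖M * (1 - R)‖ ≤ σ := by
      rw [hR, ← spanProj_compl, hM, spanProj, diagOp_mul]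
      refine norm_diagOp_le w hσ.le fun i => ?_
      by_cases hi : i ∈ J
      · simp [hi, hσ.le]
      · have := hout i hi
        simp only [Pi.mul_apply, Finset.mem_compl, hi, not_false_eq_true, if_true, mul_one]
        linarith [hs.lt]
    -- Exchanging the two projections is legitimate because their ranks agree; the Sylvester and
    -- kernel estimates concern only `R * Q` and `R * N`.
    have h3 : ‖(1 - R) * P‖ ≤ ‖R * Q‖ + ‖R * N‖ := by
      refine (norm_spanProj_compl_mul_le u w hcard).trans ?_
      rw [← hP, ← hR, h1P, mul_add]
      exact norm_add_le _ _
    rw [h1]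
    calc ‖P * (M * (1 - R)) * ((1 - R) * P)‖ ≤ ‖P * (M * (1 - R))‖ * ‖(1 - R) * P‖ :=
          norm_mul_le _ _
      _ ≤ σ * (‖R * Q‖ + ‖R * N‖) := by
          gcongr
          exact (norm_mul_le _ _).trans ((mul_le_of_le_one_left (norm_nonneg _) nP).trans h2)
      _ ≤ _ := by linarith
  have b4 : ‖P * E * P‖ ≤ e :=
    (norm_mul_le _ _).trans ((mul_le_of_le_one_right (norm_nonneg _) nP).trans
      ((norm_mul_le _ _).trans ((mul_le_of_le_one_left (norm_nonneg _) nP).trans nE)))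
  have hdec : M * R - A * P = M * R * (1 - P) + (1 - P) * (M * R) * P + P * E * P -
      P * (M * (1 - R)) * P := by
    have h1 : P * A * P = A * P := by rw [← hAP, mul_assoc, hPP]
    have h2 : P * E * P = P * M * P - A * P := by rw [← h1, hE]; noncomm_ring
    rw [h2]; noncomm_ring
  rw [hdec]
  have q1 : 0 ≤ σ * x / d + y / d := by positivity
  refine (_root_.norm_sub_le _ _).trans ?_
  have := norm_add₃_le (a := M * R * (1 - P)) (b := (1 - P) * (M * R) * P) (c := P * E * P)
  linarith

end Blocks

end Core

/-! ### From matrices to operators: best rank p approximations as spectral parts. -/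

section MatrixOperators

open InnerProductSpace

theorem toEuclideanCLM_outer {n : ℕ} (a b : EuclideanSpace ℝ (Fin n)) :
    Matrix.toEuclideanCLM (n := Fin n) (𝕜 := ℝ) (outer a b) = rankOne ℝ a b := by
  ext v i
  simp only [Matrix.ofLp_toEuclideanCLM, outer, Matrix.mulVec, dotProduct, Matrix.of_apply,
    rankOne_apply, PiLp.smul_apply, smul_eq_mul, PiLp.inner_apply, RCLike.inner_apply,
    Finset.sum_mul]
  refine Finset.sum_congr rfl fun j _ => ?_
  simp only [conj_trivial]
  ring

theorem IsSpectralDecomp.toEuclideanCLM_eq {n : ℕ} {A : Matrix (Fin n) (Fin n) ℝ} {lam : Fin n → ℝ}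
    {u : OrthonormalBasis (Fin n) ℝ (EuclideanSpace ℝ (Fin n))} (h : IsSpectralDecomp A lam u) :
    Matrix.toEuclideanCLM (n := Fin n) (𝕜 := ℝ) A = diagOp u lam := by
  rw [h.eq_sum, map_sum, diagOp]
  exact Finset.sum_congr rfl fun i _ => by rw [map_smul, toEuclideanCLM_outer]

theorem exists_toEuclideanCLM_eq_diagOp {n : ℕ} {M : Matrix (Fin n) (Fin n) ℝ} (hM : M.IsSymm) :
    ∃ (w : OrthonormalBasis (Fin n) ℝ (EuclideanSpace ℝ (Fin n))) (μ : Fin n → ℝ),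
      Matrix.toEuclideanCLM (n := Fin n) (𝕜 := ℝ) M = diagOp w μ := by
  have hT : (Matrix.toEuclideanLin M).IsSymmetric := by
    rw [Matrix.isSymmetric_toEuclideanLin_iff, Matrix.IsHermitian, Matrix.conjTranspose_eq_transpose_of_trivial]
    exact hM
  have hn : Module.finrank ℝ (EuclideanSpace ℝ (Fin n)) = n := finrank_euclideanSpace_fin
  refine ⟨hT.eigenvectorBasis hn, hT.eigenvalues hn, eq_diagOp_of_apply _ _ _ fun i => ?_⟩
  exact hT.apply_eigenvectorBasis hn i

theorem mem_iff_lt_card_of_isLowerSet {ρ : ℕ} {K : Finset (Fin ρ)}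
    (hK : ∀ i j, i ≤ j → j ∈ K → i ∈ K) (i : Fin ρ) : i ∈ K ↔ i.val < K.card := by
  constructor
  · intro hi
    have : Finset.Iic i ⊆ K := fun j hj => hK j i (Finset.mem_Iic.1 hj) hi
    have := Finset.card_le_card this
    rw [Fin.card_Iic] at this
    omega
  · intro hi
    by_contra h
    have : K ⊆ Finset.Iio i := by
      intro j hj
      rw [Finset.mem_Iio]
      by_contra hij
      exact h (hK i j (not_lt.1 hij) hj)
    have := Finset.card_le_card this
    rw [Fin.card_Iio] at this
    omega

/-- A best rank `p` approximation of a symmetric matrix with a gap in the absolute values of its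
eigenvalues is its part on the `p` leading eigenvectors. -/
theorem IsRankApprox.toEuclideanCLM_eq {n p : ℕ} {M B : Matrix (Fin n) (Fin n) ℝ}
    (hB : IsRankApprox p M B) {w : OrthonormalBasis (Fin n) ℝ (EuclideanSpace ℝ (Fin n))}
    {μ : Fin n → ℝ} (hM : Matrix.toEuclideanCLM (n := Fin n) (𝕜 := ℝ) M = diagOp w μ)
    {J : Finset (Fin n)} (hJ : J.card = p) {τ : ℝ} (hτ : 0 ≤ τ) (hin : ∀ i ∈ J, τ < |μ i|)
    (hout : ∀ i ∉ J, |μ i| < τ) :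
    Matrix.toEuclideanCLM (n := Fin n) (𝕜 := ℝ) B = diagOp w μ * spanProj w J := by
  obtain ⟨ρ, s, a, b, hsvd, rfl⟩ := hB
  set T := diagOp w μ with hT
  have hTsum : T = ∑ i, s i • rankOne ℝ (a i) (b i) := by
    rw [← hM, hsvd.eq_sum, map_sum]
    exact Finset.sum_congr rfl fun i _ => by rw [map_smul, toEuclideanCLM_outer]
  have hTv : ∀ v, T v = ∑ i, (s i * inner ℝ (b i) v) • a i := by
    intro v
    rw [hTsum]
    simp [smul_smul]
  have hTb : ∀ j, T (b j) = s j • a j := by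
    intro j
    rw [hTv]
    simp [orthonormal_iff_ite.1 hsvd.right_orthonormal]
  have hTa : ∀ j, T (a j) = s j • b j := by
    intro j
    refine ext_inner_right ℝ fun v => ?_
    rw [hT, inner_diagOp_comm, ← hT, hTv, inner_sum]
    simp [inner_smul_right, inner_smul_left, orthonormal_iff_ite.1 hsvd.left_orthonormal]
  -- `b j` is an eigenvector of `T * T` with eigenvalue `s j ^ 2`, so it has components only along
  -- the `w i` with `|μ i| = s j`.
  have hev : ∀ i j, inner ℝ (w i) (b j) ≠ 0 → |μ i| = s j := by
    intro i j hij
    have h1 : inner ℝ (w i) (T (T (b j))) = μ i * (μ i * inner ℝ (w i) (b j)) := by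
      rw [hT, inner_diagOp, inner_diagOp]
    rw [hTb, map_smul, hTa, smul_smul, inner_smul_right, ← mul_assoc] at h1
    have h2 := mul_right_cancel₀ hij h1
    rw [← abs_of_nonneg (hsvd.nonneg j), ← sq_eq_sq_iff_abs_eq_abs]
    linarith
  set K := Finset.univ.filter fun j => τ < s j with hK
  have hKin : ∀ j ∈ K, ∀ i ∉ J, inner ℝ (w i) (b j) = 0 := by
    intro j hj i hi
    by_contra h
    have h1 := hev i j h
    have h2 := hout i hi
    simp only [hK, Finset.mem_filter, Finset.mem_univ, true_and] at hj
    linarith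
  have hKout : ∀ j ∉ K, ∀ i ∈ J, inner ℝ (w i) (b j) = 0 := by
    intro j hj i hi
    by_contra h
    have h1 := hev i j h
    have h2 := hin i hi
    simp only [hK, Finset.mem_filter, Finset.mem_univ, true_and, not_lt] at hj
    linarith
  -- Double counting of the squared entries `inner ℝ (w i) (b j) ^ 2` over `J × K`, all of whose
  -- rows and columns sum to 1. The `b j` need not span, so the row sums come from computing `‖T (w
  -- i)‖ ^ 2` in two ways.
  have hcard : K.card = p := by
    have h1 : ∀ i ∈ J, ∑ j ∈ K, inner ℝ (w i) (b j) ^ 2 = (1 : ℝ) := by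
      intro i hi
      have hμ : 0 < |μ i| := hτ.trans_lt (hin i hi)
      have h2 : ‖T (w i)‖ ^ 2 = μ i ^ 2 := by
        rw [hT, diagOp_basis, norm_smul, w.orthonormal.1 i, mul_one, Real.norm_eq_abs, sq_abs]
      have h3 : ‖T (w i)‖ ^ 2 = ∑ j, (s j * inner ℝ (b j) (w i)) ^ 2 := by
        rw [hTv, ← real_inner_self_eq_norm_sq, hsvd.left_orthonormal.inner_sum]
        simp [sq]
      have h4 : ∑ j, (s j * inner ℝ (b j) (w i)) ^ 2 =
          μ i ^ 2 * ∑ j ∈ K, inner ℝ (w i) (b j) ^ 2 := by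
        rw [Finset.mul_sum, ← Finset.sum_subset (Finset.subset_univ K)]
        · refine Finset.sum_congr rfl fun j _ => ?_
          rw [real_inner_comm]
          by_cases h0 : inner ℝ (w i) (b j) = 0
          · simp [h0]
          · rw [← hev i j h0, mul_pow, sq_abs]
        · intro j _ hj
          rw [real_inner_comm, hKout j hj i hi]
          simp
      have h5 : μ i ^ 2 ≠ 0 := by
        have := abs_pos.1 hμ
        positivity
      rw [h3, h4] at h2
      exact mul_left_cancel₀ h5 (by rw [h2, mul_one])
    have h2 : ∀ j ∈ K, ∑ i ∈ J, inner ℝ (w i) (b j) ^ 2 = (1 : ℝ) := by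
      intro j hj
      have h3 := w.norm_sq_eq_sum (b j)
      rw [hsvd.right_orthonormal.1 j, one_pow] at h3
      rw [h3]
      refine Finset.sum_subset (Finset.subset_univ J) fun i _ hi => ?_
      rw [hKin j hj i hi]
      simp
    have h3 : (K.card : ℝ) = J.card := by
      calc (K.card : ℝ) = ∑ j ∈ K, ∑ i ∈ J, inner ℝ (w i) (b j) ^ 2 := by
            rw [Finset.sum_congr rfl h2]; simp
        _ = ∑ i ∈ J, ∑ j ∈ K, inner ℝ (w i) (b j) ^ 2 := Finset.sum_comm
        _ = J.card := by rw [Finset.sum_congr rfl h1]; simp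
    rw [← hJ]
    exact_mod_cast h3
  have hKp : (Finset.univ.filter fun i : Fin ρ => i.val < p) = K := by
    ext i
    rw [mem_iff_lt_card_of_isLowerSet (K := K) _ i, hcard]
    · simp
    · intro i j hij hj
      simp only [hK, Finset.mem_filter, Finset.mem_univ, true_and] at hj ⊢
      exact hj.trans_le (hsvd.antitone hij)
  rw [hKp, map_sum]
  ext1 v
  rw [mul_apply_eq_comp, hTv, ← Finset.sum_subset (Finset.subset_univ K)]
  · simp only [map_smul, toEuclideanCLM_outer, sum_apply, smul_apply, rankOne_apply, smul_smul]
    refine Finset.sum_congr rfl fun j hj => ?_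
    have : spanProj w J (b j) = b j := by
      refine w.ext_inner fun i => ?_
      rw [inner_spanProj]
      split_ifs with hi
      · rfl
      · exact (hKin j hj i hi).symm
    rw [spanProj, ← inner_diagOp_comm, ← spanProj, this]
  · intro j _ hj
    have : spanProj w J (b j) = 0 := by
      refine w.ext_inner fun i => ?_
      rw [inner_spanProj, inner_zero_right]
      split_ifs with hi
      · exact hKout j hj i hi
      · rfl
    rw [spanProj, ← inner_diagOp_comm, ← spanProj, this, inner_zero_left, mul_zero, zero_smul]

/-- An orthonormal family in dimension `n` has at most `n` members, so truncation at `n` removes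
nothing. -/
theorem IsRankApprox.eq_self {n : ℕ} {M B : Matrix (Fin n) (Fin n) ℝ}
    (hB : IsRankApprox n M B) : B = M := by
  obtain ⟨ρ, s, a, b, hsvd, rfl⟩ := hB
  have hρ : ρ ≤ n := by
    simpa using hsvd.left_orthonormal.linearIndependent.fintype_card_le_finrank
  have huniv : (Finset.univ.filter fun i : Fin ρ => i.val < n) = Finset.univ :=
    Finset.filter_true_of_mem fun i _ => i.isLt.trans_le hρ
  rw [huniv]
  exact hsvd.eq_sum.symm

end MatrixOperators

/-! ### Singular values as absolute values of eigenvalues. -/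

section SingularValues

variable {n : ℕ} {A : Matrix (Fin n) (Fin n) ℝ} {lam : Fin n → ℝ}
    {u : OrthonormalBasis (Fin n) ℝ (EuclideanSpace ℝ (Fin n))}

theorem sval_nonneg {m n : ℕ} (M : Matrix (Fin m) (Fin n) ℝ) (i : ℕ) : 0 ≤ sval M i :=
  LinearMap.singularValues_nonneg _ _

theorem sval_antitone {m n : ℕ} (M : Matrix (Fin m) (Fin n) ℝ) : Antitone (sval M) :=
  fun _ _ h => LinearMap.singularValues_antitone _ (Nat.sub_le_sub_right h 1)

/-- In the basis `u`, the composite of the adjoint with the operator is diagonal with entries `lam i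
^ 2`. Comparing the roots of its characteristic polynomial with its eigenvalues and taking square
roots gives the equality with multiplicity. -/
theorem IsSpectralDecomp.map_abs_eq (h : IsSpectralDecomp A lam u) :
    (Finset.univ : Finset (Fin n)).val.map (fun i => |lam i|) =
      (Multiset.range n).map fun i => sval A (i + 1) := by
  set T := Matrix.toEuclideanLin A with hTdef
  have hT : T = (diagOp u lam : EuclideanSpace ℝ (Fin n) →ₗ[ℝ] EuclideanSpace ℝ (Fin n)) := by
    rw [← h.toEuclideanCLM_eq, Matrix.coe_toEuclideanCLM_eq_toEuclideanLin]
  have hadj : LinearMap.adjoint T = T := by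
    rw [eq_comm, LinearMap.eq_adjoint_iff, hT]
    exact inner_diagOp_comm u lam
  have hn : Module.finrank ℝ (EuclideanSpace ℝ (Fin n)) = n := finrank_euclideanSpace_fin
  have h1 := T.isSymmetric_adjoint_comp_self.roots_charpoly_eq_eigenvalues hn
  have h2 : (LinearMap.adjoint T ∘ₗ T).charpoly.roots =
      (Finset.univ : Finset (Fin n)).val.map fun i => lam i ^ 2 := by
    rw [← LinearMap.charpoly_toMatrix _ u.toBasis]
    have : LinearMap.toMatrix u.toBasis u.toBasis (LinearMap.adjoint T ∘ₗ T) =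
        Matrix.diagonal fun i => lam i ^ 2 := by
      ext i j
      rw [LinearMap.toMatrix_apply, hadj, hT]
      simp only [OrthonormalBasis.coe_toBasis, LinearMap.comp_apply, ContinuousLinearMap.coe_coe,
        OrthonormalBasis.coe_toBasis_repr_apply, OrthonormalBasis.repr_apply_apply, inner_diagOp,
        u.inner_eq_ite, Matrix.diagonal_apply]
      split_ifs <;> ring
    rw [this, Matrix.charpoly_diagonal, Polynomial.roots_prod _ _
      (Finset.prod_ne_zero_iff.2 fun i _ => Polynomial.X_sub_C_ne_zero _)]
    simp only [Polynomial.roots_X_sub_C]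
    exact Multiset.bind_singleton _ _
  have h3 := congrArg (Multiset.map Real.sqrt) (h2.symm.trans h1)
  rw [Multiset.map_map, Multiset.map_map] at h3
  have h4 : (Multiset.range n) = (Finset.univ : Finset (Fin n)).val.map Fin.val := by
    rw [Fin.univ_val_map, List.ofFn_eq_map, List.map_coe_finRange_eq_range]
    rfl
  rw [h4, Multiset.map_map]
  refine Eq.trans ?_ (h3.trans ?_)
  · simp [Real.sqrt_sq_eq_abs]
  · refine Multiset.map_congr rfl fun i _ => ?_
    simp only [Function.comp_apply, sval, Nat.add_sub_cancel]
    rw [← hTdef, T.singularValues_fin hn i]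
    rfl

theorem IsSpectralDecomp.card_support_le (h : IsSpectralDecomp A lam u) :
    (Finset.univ.filter fun i => lam i ≠ 0).card ≤ A.rank := by
  have h1 : LinearIndependent ℝ fun i : {i // lam i ≠ 0} => u i :=
    u.orthonormal.linearIndependent.comp _ Subtype.val_injective
  have h2 : ∀ i : {i // lam i ≠ 0}, u i ∈ LinearMap.range (Matrix.toEuclideanLin A) := by
    intro i
    refine ⟨(lam i)⁻¹ • u i, ?_⟩
    rw [map_smul, ← Matrix.coe_toEuclideanCLM_eq_toEuclideanLin, h.toEuclideanCLM_eq,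
      ContinuousLinearMap.coe_coe, diagOp_basis, smul_smul, inv_mul_cancel₀ i.2, one_smul]
  have h3 : LinearIndependent ℝ
      fun i : {i // lam i ≠ 0} => (⟨u i, h2 i⟩ : LinearMap.range (Matrix.toEuclideanLin A)) :=
    LinearIndependent.of_comp (LinearMap.range (Matrix.toEuclideanLin A)).subtype h1
  have h4 := h3.fintype_card_le_finrank
  rw [Fintype.card_subtype] at h4
  rw [Matrix.rank_eq_finrank_range_toLin A (PiLp.basisFun 2 ℝ (Fin n)) (PiLp.basisFun 2 ℝ (Fin n)),
    ← Matrix.toLpLin_eq_toLin]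
  exact h4

variable {p k : ℕ}

theorem IsLeadingSplit.card_eq (hk : IsLeadingSplit A lam p k) : (leadingSet n p k).card = p := by
  have := congrArg Multiset.card hk.abs_eq
  simpa using this

theorem IsLeadingSplit.sval_le (hk : IsLeadingSplit A lam p k) {i : Fin n}
    (hi : i ∈ leadingSet n p k) : sval A p ≤ |lam i| := by
  have h1 : |lam i| ∈ (leadingSet n p k).val.map fun i => |lam i| :=
    Multiset.mem_map_of_mem _ hi
  rw [hk.abs_eq, Multiset.mem_map] at h1
  obtain ⟨j, hj, hj'⟩ := h1
  rw [← hj']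
  exact sval_antitone A (Multiset.mem_range.1 hj)

/-- Cancelling the leading part from the equality of full multisets leaves the singular values of
index at least `p + 1`. -/
theorem IsLeadingSplit.le_sval (h : IsSpectralDecomp A lam u) (hk : IsLeadingSplit A lam p k)
    {i : Fin n} (hi : i ∉ leadingSet n p k) : |lam i| ≤ sval A (p + 1) := by
  have hpn : p ≤ n := by
    rw [← hk.card_eq]
    simpa using Finset.card_le_univ (leadingSet n p k)
  have h1 : (leadingSet n p k)ᶜ.val.map (fun i => |lam i|) =
      ((Multiset.range (n - p)).map fun j => p + j).map fun i => sval A (i + 1) := by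
    have h2 : (Finset.univ : Finset (Fin n)).val =
        (leadingSet n p k).val + (leadingSet n p k)ᶜ.val := by
      rw [← Finset.union_compl (leadingSet n p k), ← Finset.disjUnion_eq_union _ _ disjoint_compl_right]
      rfl
    have h3 : Multiset.range n =
        Multiset.range p + (Multiset.range (n - p)).map fun j => p + j := by
      conv_lhs => rw [← Nat.add_sub_cancel' hpn]
      rw [Multiset.range_add]
    have h4 := h.map_abs_eq
    rw [h2, h3, Multiset.map_add, Multiset.map_add, hk.abs_eq] at h4
    exact add_left_cancel h4
  have h2 : |lam i| ∈ (leadingSet n p k)ᶜ.val.map fun i => |lam i| :=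
    Multiset.mem_map_of_mem _ (Finset.mem_compl.2 hi)
  rw [h1, Multiset.map_map, Multiset.mem_map] at h2
  obtain ⟨j, -, hj⟩ := h2
  rw [← hj]
  exact sval_antitone A (Nat.succ_le_succ (Nat.le_add_right p j))

end SingularValues

/-! ### The skewness parameters as bounds on entries. -/

section Skewness

variable {n : ℕ} (E : Matrix (Fin n) (Fin n) ℝ) (lam : Fin n → ℝ)
    (u : OrthonormalBasis (Fin n) ℝ (EuclideanSpace ℝ (Fin n)))

theorem skewX_nonneg : 0 ≤ skewX E lam u := Real.iSup_nonneg fun _ => abs_nonneg _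

theorem skewY_nonneg : 0 ≤ skewY E lam u := Real.iSup_nonneg fun _ => abs_nonneg _

theorem abs_inner_le_skewX {i j : Fin n} (hi : lam i ≠ 0) (hj : lam j ≠ 0) :
    |inner ℝ (u i) (Matrix.toEuclideanLin E (u j))| ≤ skewX E lam u :=
  le_ciSup (f := fun ij : {ij : Fin n × Fin n // lam ij.1 ≠ 0 ∧ lam ij.2 ≠ 0} =>
    |inner ℝ (u ij.1.1) (Matrix.toEuclideanLin E (u ij.1.2))|)
    (Set.finite_range _).bddAbove ⟨(i, j), hi, hj⟩

theorem abs_inner_le_skewY {i j : Fin n} (hij : i ≠ j) (hi : lam i ≠ 0) (hj : lam j ≠ 0) :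
    |inner ℝ (Matrix.toEuclideanLin E (u i)) (Matrix.toEuclideanLin E (u j))| ≤
      skewY E lam u := by
  have key : ∀ i j : Fin n, i < j → lam i ≠ 0 → lam j ≠ 0 →
      |inner ℝ (Matrix.toEuclideanLin E (u i)) (Matrix.toEuclideanLin E (u j))| ≤
        skewY E lam u := fun i j hij hi hj =>
    le_ciSup (f := fun ij : {ij : Fin n × Fin n // ij.1 < ij.2 ∧ lam ij.1 ≠ 0 ∧ lam ij.2 ≠ 0} =>
      |inner ℝ (Matrix.toEuclideanLin E (u ij.1.1)) (Matrix.toEuclideanLin E (u ij.1.2))|)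
      (Set.finite_range _).bddAbove ⟨(i, j), hij, hi, hj⟩
  rcases lt_or_gt_of_ne hij with h | h
  · exact key i j h hi hj
  · rw [real_inner_comm]
    exact key j i h hj hi

end Skewness

/-! ### The eigenvalue gap with its infinite conventions. -/

section EigGap

variable {n : ℕ} {lam : Fin n → ℝ}

theorem eigExt_succ {i : ℕ} (h : i < n) : eigExt lam (i + 1) = (lam ⟨i, h⟩ : EReal) := by
  simp [eigExt, h]

theorem eigExt_succ_of_le {i : ℕ} (h : n ≤ i) : eigExt lam (i + 1) = ⊥ := by
  simp [eigExt, h]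

theorem eigExt_sub_nonneg (hlam : Antitone lam) {i : ℕ} (hi : i ≤ n) :
    0 ≤ eigExt lam i - eigExt lam (i + 1) := by
  have h0 : eigExt lam 0 = ⊤ := by simp [eigExt]
  rcases i with _ | i
  · rw [h0]
    rcases Nat.eq_zero_or_pos n with hn | hn
    · rw [eigExt_succ_of_le hn.le]; simp
    · rw [eigExt_succ hn, EReal.top_sub_coe]; simp
  · rw [eigExt_succ (i := i) (by omega)]
    rcases hi.eq_or_lt with hn | hn
    · rw [eigExt_succ_of_le hn.ge]
      simp
    · rw [eigExt_succ hn, ← EReal.coe_sub]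
      exact_mod_cast sub_nonneg.2 (hlam (by simp))

theorem eigGap_nonneg (hlam : Antitone lam) {p k : ℕ} (hk : k ≤ n) : 0 ≤ eigGap lam p k :=
  le_min (eigExt_sub_nonneg hlam hk) (eigExt_sub_nonneg hlam (Nat.sub_le _ _))

/-- If `p < n`, then `δ_S` is the least of those differences in its definition that are real. -/
theorem exists_eigGap_eq_coe (lam : Fin n → ℝ) {p k : ℕ} (hp : 1 ≤ p) (hpn : p < n) (hk : k ≤ p)
    {δ : ℝ} (h1 : ∀ i j : Fin n, i.val + 1 = k → j.val = k → δ ≤ lam i - lam j)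
    (h2 : ∀ i j : Fin n, i.val + 1 = n - (p - k) → j.val = n - (p - k) → δ ≤ lam i - lam j) :
    ∃ d : ℝ, eigGap lam p k = d ∧ δ ≤ d ∧
      (∀ i j : Fin n, i.val + 1 = k → j.val = k → d ≤ lam i - lam j) ∧
      (∀ i j : Fin n, i.val + 1 = n - (p - k) → j.val = n - (p - k) → d ≤ lam i - lam j) := by
  have h0 : eigExt lam 0 = ⊤ := by simp [eigExt]
  have val : ∀ (i : Fin n) (m : ℕ), i.val + 1 = m → eigExt lam m = (lam i : EReal) := by
    rintro i m rfl
    exact eigExt_succ i.isLt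
  -- As `p < n`, the eigenvalues λ_{k+1} and λ_{n-(p-k)} always exist; only λ_k and λ_{n-(p-k)+1}
  -- can be infinite, for k = 0 and k = p. These cases exclude each other since `1 ≤ p`, so the
  -- minimum is real.
  obtain ⟨b, hb⟩ : ∃ b : Fin n, b.val = k := ⟨⟨k, by omega⟩, rfl⟩
  obtain ⟨c, hc⟩ : ∃ c : Fin n, c.val + 1 = n - (p - k) :=
    ⟨⟨n - (p - k) - 1, by omega⟩, by simp only; omega⟩
  have eb := val b (k + 1) (by rw [hb])
  have ec := val c _ hc
  have uniq1 : ∀ a i j : Fin n, a.val + 1 = k → i.val + 1 = k → j.val = k →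
      lam a - lam b ≤ lam i - lam j := fun a i j ha hi hj => by
    rw [show a = i from Fin.ext (by omega), show b = j from Fin.ext (by omega)]
  have uniq2 : ∀ e i j : Fin n, e.val = n - (p - k) → i.val + 1 = n - (p - k) →
      j.val = n - (p - k) → lam c - lam e ≤ lam i - lam j := fun e i j he hi hj => by
    rw [show c = i from Fin.ext (by omega), show e = j from Fin.ext (by omega)]
  have top1 : k = 0 → eigExt lam k - eigExt lam (k + 1) = ⊤ := by
    intro hk0
    rw [eb, hk0, h0, EReal.top_sub_coe]
  have top2 : k = p → eigExt lam (n - (p - k)) - eigExt lam (n - (p - k) + 1) = ⊤ := by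
    intro hkp
    rw [ec, eigExt_succ_of_le (by omega)]
    simp
  have real1 : ∀ a : Fin n, a.val + 1 = k →
      eigExt lam k - eigExt lam (k + 1) = ((lam a - lam b : ℝ) : EReal) := fun a ha => by
    rw [eb, val a k ha, EReal.coe_sub]
  have real2 : ∀ e : Fin n, e.val = n - (p - k) →
      eigExt lam (n - (p - k)) - eigExt lam (n - (p - k) + 1) =
        ((lam c - lam e : ℝ) : EReal) := fun e he => by
    rw [ec, val e _ (by rw [he]), EReal.coe_sub]
  have exa : k ≠ 0 → ∃ a : Fin n, a.val + 1 = k := fun h =>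
    ⟨⟨k - 1, by omega⟩, by simp only; omega⟩
  have exe : k < p → ∃ e : Fin n, e.val = n - (p - k) := fun h => ⟨⟨n - (p - k), by omega⟩, rfl⟩
  rcases Nat.eq_zero_or_pos k with hk0 | hk0
  · obtain ⟨e, he⟩ := exe (by omega)
    refine ⟨lam c - lam e, ?_, h2 c e hc he, fun i j hi => by omega, fun i j => uniq2 e i j he⟩
    rw [eigGap, top1 hk0, real2 e he, min_eq_right le_top]
  obtain ⟨a, ha⟩ := exa hk0.ne'
  rcases hk.eq_or_lt with hkp | hkp
  · refine ⟨lam a - lam b, ?_, h1 a b ha hb, fun i j => uniq1 a i j ha, fun i j hi hj => ?_⟩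
    · rw [eigGap, top2 hkp, real1 a ha, min_eq_left le_top]
    · clear exe
      have := j.isLt
      omega
  · obtain ⟨e, he⟩ := exe hkp
    refine ⟨min (lam a - lam b) (lam c - lam e), ?_, le_min (h1 a b ha hb) (h2 c e hc he),
      fun i j hi hj => (min_le_left _ _).trans (uniq1 a i j ha hi hj),
      fun i j hi hj => (min_le_right _ _).trans (uniq2 e i j he hi hj)⟩
    rw [eigGap, real1 a ha, real2 e he]
    exact (EReal.coe_strictMono.monotone.map_min).symm

end EigGap

/-! ### Assembly of the matrix theorem. -/

/-- The split of the spectrum into `k` leading positive, `p - k` leading negative and trailing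
eigenvalues. -/
theorem IsLeadingSplit.splitSpectrum {n p k : ℕ} {A : Matrix (Fin n) (Fin n) ℝ} {lam : Fin n → ℝ}
    {u : OrthonormalBasis (Fin n) ℝ (EuclideanSpace ℝ (Fin n))} (hspec : IsSpectralDecomp A lam u)
    (hk : IsLeadingSplit A lam p k) (hp : 1 ≤ p) (hpn : p < n) (hgap : 0 < svalGap A p) :
    ∃ α β d : ℝ, eigGap lam p k = d ∧
      SplitSpectrum lam (Finset.univ.filter fun i => i.val < k)
        (Finset.univ.filter fun i => n - (p - k) ≤ i.val) α β (sval A p) (sval A (p + 1)) d := by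
  have hkp := hk.le
  have hlam := hspec.antitone
  have hgap' : sval A (p + 1) < sval A p := sub_pos.1 hgap
  have hσ' := sval_nonneg A (p + 1)
  have mem : ∀ i : Fin n, i ∈ leadingSet n p k ↔ i.val < k ∨ n - (p - k) ≤ i.val := fun i => by
    simp [leadingSet]
  have hpos : ∀ i : Fin n, i.val < k → sval A p ≤ lam i := fun i hi => by
    rw [← abs_of_pos (hk.pos i hi)]
    exact hk.sval_le ((mem i).2 (Or.inl hi))
  have hneg : ∀ i : Fin n, n - (p - k) ≤ i.val → lam i ≤ -sval A p := fun i hi => by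
    have := hk.sval_le ((mem i).2 (Or.inr hi))
    rw [abs_of_nonpos (hk.nonpos i hi)] at this
    linarith
  have hrest : ∀ i : Fin n, k ≤ i.val → i.val < n - (p - k) → |lam i| ≤ sval A (p + 1) :=
    fun i h1 h2 => hk.le_sval hspec fun h => by rcases (mem i).1 h with h | h <;> omega
  obtain ⟨d, hd, hδ, hd1, hd2⟩ := exists_eigGap_eq_coe lam hp hpn hkp (δ := svalGap A p)
    (fun i j hi hj => by
      have h1 := hpos i (by omega)
      have h2 := (le_abs_self _).trans (hrest j (by omega) (by omega))
      rw [svalGap]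
      linarith)
    (fun i j hi hj => by
      have h1 := hneg j (by omega)
      have h2 := (neg_le_abs _).trans (hrest i (by omega) (by omega))
      rw [svalGap]
      linarith)
  rw [svalGap] at hδ
  obtain ⟨α, hα, hαs, hαr⟩ : ∃ α, sval A p ≤ α ∧ (∀ i : Fin n, i.val < k → α ≤ lam i) ∧
      ∀ i : Fin n, k ≤ i.val → i.val < n - (p - k) → lam i ≤ α - d := by
    rcases Nat.eq_zero_or_pos k with hk0 | hk0
    -- With `k = 0` there is no positive leading eigenvalue to bound, and `α` is free to be so large
    -- that `α - d = sval A p` dominates the rest.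
    · refine ⟨sval A p + d, by linarith, fun i hi => by omega, fun i h1 h2 => ?_⟩
      linarith [(le_abs_self _).trans (hrest i h1 h2)]
    · refine ⟨lam ⟨k - 1, by omega⟩, hpos _ (by simp only; omega),
        fun i hi => hlam (Fin.le_def.2 (by simp only; omega)), fun i h1 h2 => ?_⟩
      have h3 := hd1 ⟨k - 1, by omega⟩ ⟨k, by omega⟩ (by simp only; omega) rfl
      have h4 : lam i ≤ lam ⟨k, by omega⟩ := hlam (Fin.le_def.2 h1)
      linarith
  obtain ⟨β, hβ, hβs, hβr⟩ : ∃ β, sval A p ≤ β ∧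
      (∀ i : Fin n, n - (p - k) ≤ i.val → lam i ≤ -β) ∧
      ∀ i : Fin n, k ≤ i.val → i.val < n - (p - k) → -lam i ≤ β - d := by
    rcases hkp.eq_or_lt with hkp' | hkp'
    · refine ⟨sval A p + d, by linarith, fun i hi => by omega, fun i h1 h2 => ?_⟩
      linarith [(neg_le_abs _).trans (hrest i h1 h2)]
    · have hm : n - (p - k) < n := by omega
      refine ⟨-lam ⟨n - (p - k), hm⟩, ?_, fun i hi => ?_, fun i h1 h2 => ?_⟩
      · linarith [hneg ⟨n - (p - k), hm⟩ le_rfl]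
      · rw [neg_neg]
        exact hlam (Fin.le_def.2 hi)
      · have h3 := hd2 ⟨n - (p - k) - 1, by omega⟩ ⟨n - (p - k), hm⟩ (by simp only; omega) rfl
        have h4 : lam ⟨n - (p - k) - 1, by omega⟩ ≤ lam i :=
          hlam (Fin.le_def.2 (by simp only; omega))
        linarith
  refine ⟨α, β, d, hd, hσ', hgap', hα, hβ, hδ, fun i hi => hαs i (by simpa using hi),
    fun i hi => hβs i (by simpa using hi), fun i hi => ?_, fun i hi => ?_, fun i hi => ?_⟩
  all_goals
    simp only [Finset.mem_union, Finset.mem_filter, Finset.mem_univ, true_and, not_or, not_lt,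
      not_le] at hi
  · exact hrest i hi.1 hi.2
  · exact hαr i hi.1 hi.2
  · exact hβr i hi.1 hi.2

/-- The operator form of the assumptions on `E`. -/
theorem SplitSpectrum.perturbationBounds {n : ℕ} {A E : Matrix (Fin n) (Fin n) ℝ}
    {lam μ : Fin n → ℝ} {u w : OrthonormalBasis (Fin n) ℝ (EuclideanSpace ℝ (Fin n))}
    {s t : Finset (Fin n)} {α β σ σ' d : ℝ} (hs : SplitSpectrum lam s t α β σ σ' d)
    (hspec : IsSpectralDecomp A lam u)
    (hw : Matrix.toEuclideanCLM (n := Fin n) (𝕜 := ℝ) (A + E) = diagOp w μ) {r : ℕ}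
    (hr : A.rank = r) (hx : r * skewX E lam u ≤ (σ - σ') / 24) (he : ‖E‖ ≤ σ / 24)
    (he2 : ‖E‖ ^ 2 ≤ σ * (σ - σ') / 576) :
    PerturbationBounds u w lam μ s t σ σ' ‖E‖ (r * skewX E lam u) (r * skewY E lam u) := by
  have hE : diagOp w μ - diagOp u lam = Matrix.toEuclideanCLM (n := Fin n) (𝕜 := ℝ) E := by
    rw [← hw, ← hspec.toEuclideanCLM_eq, ← map_sub, add_sub_cancel_left]
  have hsymm : ∀ v v', inner ℝ ((diagOp w μ - diagOp u lam) v) v' =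
      inner ℝ v ((diagOp w μ - diagOp u lam) v') := by
    intro v v'
    rw [sub_apply, sub_apply, inner_sub_left, inner_sub_right, inner_diagOp_comm,
      inner_diagOp_comm]
  have hcard : (Finset.univ.filter fun i => lam i ≠ 0).card ≤ r := hr ▸ hspec.card_support_le
  have hZ : ∀ i ∈ Finset.univ.filter fun i => lam i ≠ 0, lam i ≠ 0 := fun i hi => by
    simpa using hi
  refine ⟨?_, ?_, ?_, hx, he, he2⟩
  · rw [hE, Matrix.l2_opNorm_toEuclideanCLM]
  · rw [hE]
    exact norm_spanProj_mul_mul_le u _ _ _ hcard hcard (skewX_nonneg E lam u) fun i hi j hj =>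
      abs_inner_le_skewX E lam u (hZ i hi) (hZ j hj)
  · refine norm_spanProj_mul_mul_le u _ _ _ ((Finset.card_le_card hs.union_subset).trans hcard)
      ((Finset.card_le_card Finset.sdiff_subset).trans hcard) (skewY_nonneg E lam u)
      fun i hi j hj => ?_
    have hj' := Finset.mem_sdiff.1 hj
    -- Symmetry of the perturbation turns entries of its square into inner products of the `E u_i`;
    -- the two index sets are disjoint, so only pairs with `i ≠ j` occur.
    rw [mul_apply_eq_comp, ← hsymm, hE]
    exact abs_inner_le_skewY E lam u (fun h => hj'.2 (h ▸ hi)) (hZ i (hs.union_subset hi))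
      (hZ j hj'.1)

theorem mainTheorem2 {n : ℕ} (A E : Matrix (Fin n) (Fin n) ℝ)
    (hA : A.IsSymm) (hE : E.IsSymm)
    (r p : ℕ) (hr : A.rank = r) (hp : 1 ≤ p) (hpr : p ≤ r)
    (lam : Fin n → ℝ) (u : OrthonormalBasis (Fin n) ℝ (EuclideanSpace ℝ (Fin n)))
    (hspec : IsSpectralDecomp A lam u)
    (k : ℕ) (hk : IsLeadingSplit A lam p k)
    (Ap A'p : Matrix (Fin n) (Fin n) ℝ)
    (hAp : IsRankApprox p A Ap) (hA'p : IsRankApprox p (A + E) A'p)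
    (hgap : 0 < svalGap A p)
    (hmax : max (p * ‖E‖ / sval A p)
        (max (r ^ 2 * skewX E lam u / svalGap A p)
          (√r * ‖E‖ / √(sval A p * svalGap A p))) ≤ 1 / 24) :
    (‖A'p - Ap‖ : EReal) ≤
      8 * (sval A p : EReal) *
        ((‖E‖ : EReal) / (sval A p : EReal)
          + (r : EReal) * (skewX E lam u : EReal) / eigGap lam p k
          + (r : EReal) ^ 2 * (skewY E lam u : EReal) /
              ((sval A p : EReal) * eigGap lam p k)) := by
  have h8 : ((8 : ℝ) : EReal) = 8 := rfl
  have hpn : p ≤ n := hpr.trans (hr ▸ A.rank_le_width)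
  have hσ' := sval_nonneg A (p + 1)
  have hσ : 0 < sval A p := by
    rw [svalGap] at hgap
    linarith
  have hx := skewX_nonneg E lam u
  have hy := skewY_nonneg E lam u
  have hr1 : (1 : ℝ) ≤ r := by exact_mod_cast hp.trans hpr
  rcases hpn.eq_or_lt with rfl | hpn
  · rw [hAp.eq_self, hA'p.eq_self, add_sub_cancel_left]
    have hg := eigGap_nonneg hspec.antitone (p := p) hk.le
    have h1 : (0 : EReal) ≤ (r : EReal) * (skewX E lam u : EReal) / eigGap lam p k :=
      EReal.div_nonneg (mul_nonneg (by positivity) (by exact_mod_cast hx)) hg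
    have h2 : (0 : EReal) ≤ (r : EReal) ^ 2 * (skewY E lam u : EReal) /
        ((sval A p : EReal) * eigGap lam p k) :=
      EReal.div_nonneg (mul_nonneg (pow_nonneg (by positivity) 2) (by exact_mod_cast hy))
        (mul_nonneg (by exact_mod_cast hσ.le) hg)
    have h3 : (‖E‖ : EReal) ≤ 8 * (sval A p : EReal) * ((‖E‖ : EReal) / (sval A p : EReal)) := by
      have : (‖E‖ : ℝ) ≤ 8 * sval A p * (‖E‖ / sval A p) := by
        rw [mul_assoc, mul_div_cancel₀ _ hσ.ne']
        linarith [norm_nonneg E]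
      rw [← h8, ← EReal.coe_div, ← EReal.coe_mul, ← EReal.coe_mul]
      exact EReal.coe_le_coe_iff.2 this
    refine h3.trans (mul_le_mul_of_nonneg_left ?_ (by positivity))
    rw [add_assoc]
    exact le_add_of_nonneg_right (add_nonneg h1 h2)
  obtain ⟨α, β, d, hd, hsplit⟩ := hk.splitSpectrum hspec hp hpn hgap
  obtain ⟨w, μ, hw⟩ := exists_toEuclideanCLM_eq_diagOp (hA.add hE)
  have hd0 : 0 < d := hgap.trans_le hsplit.gap_le
  have hmax1 := (le_max_left _ _).trans hmax
  have hmax2 := ((le_max_left _ _).trans (le_max_right _ _)).trans hmax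
  have hmax3 := ((le_max_right _ _).trans (le_max_right _ _)).trans hmax
  have he : ‖E‖ ≤ sval A p / 24 := by
    rw [div_le_iff₀ hσ] at hmax1
    have : (1 : ℝ) * ‖E‖ ≤ p * ‖E‖ := by
      gcongr
      exact_mod_cast hp
    linarith
  have hx' : r * skewX E lam u ≤ (sval A p - sval A (p + 1)) / 24 := by
    rw [div_le_iff₀ hgap, svalGap] at hmax2
    have : r * skewX E lam u ≤ r ^ 2 * skewX E lam u := by
      gcongr
      exact le_self_pow₀ hr1 two_ne_zero
    linarith
  have he2 : ‖E‖ ^ 2 ≤ sval A p * (sval A p - sval A (p + 1)) / 576 := by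
    have hpos : 0 < sval A p * svalGap A p := mul_pos hσ hgap
    rw [div_le_iff₀ (Real.sqrt_pos.2 hpos)] at hmax3
    have h1 : ‖E‖ ≤ 1 / 24 * √(sval A p * svalGap A p) := by
      refine le_trans ?_ hmax3
      exact le_mul_of_one_le_left (norm_nonneg _) (Real.one_le_sqrt.2 hr1)
    have h2 : ‖E‖ ^ 2 ≤ (1 / 24 * √(sval A p * svalGap A p)) ^ 2 := by gcongr
    rw [mul_pow, Real.sq_sqrt hpos.le, svalGap] at h2
    linarith
  have hbounds := hsplit.perturbationBounds hspec hw hr hx' he he2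
  obtain ⟨J, hJ, hin, hout, hnorm⟩ := hsplit.norm_sub_le hbounds (by positivity)
  set S := (Finset.univ.filter fun i : Fin n => i.val < k) ∪
    Finset.univ.filter fun i : Fin n => n - (p - k) ≤ i.val with hS
  have hS' : S = leadingSet n p k := by
    ext i
    simp [hS, leadingSet]
  have hcard : S.card = p := by rw [hS', hk.card_eq]
  have hlt := hsplit.lt
  have eAp := hAp.toEuclideanCLM_eq hspec.toEuclideanCLM_eq hcard
    -- A threshold strictly between the midpoint (σ_p + σ_{p+1})/2 and σ_p - rx, so it separates the
    -- leading eigenvalues of both `A` and `A + E`.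
    (τ := (3 * sval A p + sval A (p + 1)) / 4) (by positivity)
    (fun i hi => by
      have := hk.sval_le (hS' ▸ hi)
      linarith)
    (fun i hi => by
      have := hk.le_sval hspec (hS' ▸ hi)
      linarith)
  have eA'p := hA'p.toEuclideanCLM_eq hw (hJ.trans hcard) (by positivity) hin hout
  have hfinal : ‖A'p - Ap‖ ≤ 8 * sval A p * (‖E‖ / sval A p + r * skewX E lam u / d +
      r ^ 2 * skewY E lam u / (sval A p * d)) := by
    rw [← Matrix.l2_opNorm_toEuclideanCLM, map_sub, eAp, eA'p]
    refine hnorm.trans ?_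
    -- The argument yields the factor `r` for `y`; the stated `r ^ 2` is weaker because `1 ≤ r`.
    have h1 : r * skewY E lam u / d ≤ r ^ 2 * skewY E lam u / d := by
      gcongr
      exact le_self_pow₀ hr1 two_ne_zero
    have h2 : 8 * sval A p * (‖E‖ / sval A p + r * skewX E lam u / d +
        r ^ 2 * skewY E lam u / (sval A p * d)) =
        8 * (‖E‖ + sval A p * (r * skewX E lam u) / d + r ^ 2 * skewY E lam u / d) := by
      field_simp
    rw [h2]
    linarith
  have hcast := EReal.coe_le_coe_iff.2 hfinal
  simp only [EReal.coe_mul, EReal.coe_add, EReal.coe_div, EReal.coe_pow, EReal.coe_natCast,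
    h8] at hcast
  rwa [hd]
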